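/- Let $a,b,c,\alpha,\beta,\gamma$ be integers with $0\le\alpha<a$, $0\le\beta<b$, $0\le\gamma<c$, at most one of $\alpha,\beta,\gamma$ being zero, and $a+b+c+\alpha+\beta+\gamma\equiv 0 \pmod 3$. Put $$s=\tfrac13(a+b+c+\alpha+\beta+\gamma)-2,\quad A=s+2-a,\quad B=s+2-b,\quad C=s+2-c,\quad M=s+2-(\alpha+\beta+\gamma),$$ and assume $0\le M$, $0\le A\le\beta+\gamma$, $0\le B\le\alpha+\gamma$ and $0\le C\le\alpha+\beta$. Let $N$ be the integer matrix of size $(C+M)\times(C+M)$ with entries $$N_{i,j}=\binom{c}{A+j-i}\ \text{ for } 1\le i\le C,\qquad N_{i,j}=\binom{\gamma}{A+C-\beta+j-i}\ \text{ for } C+1\le i\le C+M,$$ where $\binom{n}{k}=0$ if $k<0$ or $k>n$, and the determinant of the empty matrix is $1$. Let $H$ be the punctured hexagon obtained as follows. Take an equilateral triangle of side-length $s+2$ with barycentric coordinates $u,v,w\ge 0$, $u+v+w=s+2$, subdivided into unit triangles by the lines on which $u$, $v$ or $w$ is an integer. Remove the unit triangles contained in one of the three corners $\{u\ge a\}$,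 $\{v\ge b\}$, $\{w\ge c\}$ (of side-lengths $A,B,C$) or in the puncture $\{u\ge\alpha,\ v\ge\beta,\ w\ge\gamma\}$ (a triangle of side-length $M$). A lozenge is the union of two unit triangles sharing an edge, and a lozenge tiling of $H$ is a set of lozenges such that every unit triangle of $H$ lies in exactly one of them and no lozenge contains a unit triangle outside $H$. For a field $K$ let $R=K[x,y,z]$ with its standard grading and $I=(x^a,y^b,z^c,x^\alpha y^\beta z^\gamma)\subset R$. The ideal $I$ has the weak Lefschetz property if there is $\ell\in[R/I]_1$ such that, for every $d$, the multiplication map $\times\ell\colon[R/I]_d\to[R/I]_{d+1}$ is injective or surjective. Then $H$ has at least one lozenge tiling. Moreover, if $a+b+c$ is even, then: 1. $M$ is even; 2. $\det N>0$, and $\det N$ equals the number of lozenge tilings of $H$; 3. $I$ has the weak Lefschetz property over every field $K$ of characteristic zero, and there is a number $p_0$, depending only on $a,b,c,\alpha,\beta,\gamma$, such that $I$ has the weak Lefschetz property over every infinite field $K$ whose characteristic is a prime $p\ge p_0$. -/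

import Mathlib

namespace PuncturedHexagon

/-! ### Graded quotients and the weak Lefschetz property -/

/-- The degree `d` component `[R/I]_d` of `R/I`, where `R` is a standard graded polynomial ring:
the image of the forms of degree `d`. -/
noncomputable def gradedPiece {σ K : Type*} [Field K] (I : Ideal (MvPolynomial σ K)) (d : ℕ) :
    Submodule K (MvPolynomial σ K ⧸ I) :=
  (MvPolynomial.homogeneousSubmodule σ K d).map (Ideal.Quotient.mkₐ K I).toLinearMap

/-- `R/I` has the weak Lefschetz property: for some linear form `ℓ ∈ [R/I]_1`, every multiplication
map `×ℓ : [R/I]_d → [R/I]_{d+1}` is injective or surjective. -/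
def HasWLP {σ K : Type*} [Field K] (I : Ideal (MvPolynomial σ K)) : Prop :=
  ∃ ℓ ∈ gradedPiece I 1, ∀ d : ℕ,
    Set.InjOn (fun f => ℓ * f) (gradedPiece I d : Set (MvPolynomial σ K ⧸ I)) ∨
    Set.SurjOn (fun f => ℓ * f) (gradedPiece I d : Set (MvPolynomial σ K ⧸ I))
      (gradedPiece I (d + 1) : Set (MvPolynomial σ K ⧸ I))

open MvPolynomial in
/-- The ideal `(x^a, y^b, z^c, x^α y^β z^γ)` of `K[x, y, z]`. -/
noncomputable def amaci (K : Type*) [Field K] (a b c α β γ : ℕ) :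
    Ideal (MvPolynomial (Fin 3) K) :=
  Ideal.span {X 0 ^ a, X 1 ^ b, X 2 ^ c, X 0 ^ α * X 1 ^ β * X 2 ^ γ}

/-! ### The binomial matrix -/

/-- The binomial coefficient `n` over `k` for an integer `k`; it is `0` for negative `k`. -/
def binom (n : ℕ) (k : ℤ) : ℤ := if 0 ≤ k then (n.choose k.toNat : ℤ) else 0

/-- The square matrix of size `C + M` with entries `binom c (A + j - i)` in the first `C` rows and
`binom γ (A + C - β + j - i)` in the last `M` rows. Rows and columns are numbered from `0` here;
the entries involve only the difference `j - i`. -/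
def matrixN (A C M c β γ : ℕ) : Matrix (Fin (C + M)) (Fin (C + M)) ℤ :=
  Matrix.of fun i j =>
    if (i : ℕ) < C then binom c ((A : ℤ) + (j : ℕ) - (i : ℕ))
    else binom γ ((A : ℤ) + C - β + (j : ℕ) - (i : ℕ))

/-! ### The punctured hexagon and its lozenge tilings

Take an equilateral triangle of side-length `s + 2`, with barycentric coordinates
`u, v, w ≥ 0`, `u + v + w = s + 2`, cut into unit triangles by the lines on which `u`, `v` or `w`
is an integer. The unit triangle with minimal coordinates `i, j, k` is recorded as the triple
`(i, j, k)`, which is also the monomial `x^i y^j z^k`. The triples with `i + j + k = s + 1` are the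
unit triangles oriented as the large triangle, those with `i + j + k = s` are the others, and two
unit triangles share an edge exactly when one triple arises from the other by adding `1` to one
entry. -/

/-- The punctured hexagon: the triangle of side-length `s + 2` without the three corner triangles
`u ≥ a`, `v ≥ b`, `w ≥ c` and without the puncture `u ≥ α, v ≥ β, w ≥ γ`. As a set of monomials
this is the union of the monomial bases of `[R/I]_s` and `[R/I]_{s+1}` for the ideal
`I = (x^a, y^b, z^c, x^α y^β z^γ)`. -/
def region (s a b c α β γ : ℕ) : Set (ℕ × ℕ × ℕ) :=
  {t | (t.1 + t.2.1 + t.2.2 = s ∨ t.1 + t.2.1 + t.2.2 = s + 1) ∧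
    t.1 < a ∧ t.2.1 < b ∧ t.2.2 < c ∧ ¬ (α ≤ t.1 ∧ β ≤ t.2.1 ∧ γ ≤ t.2.2)}

/-- A lozenge: the union of two unit triangles that share an edge. -/
def IsLozenge (L : Set (ℕ × ℕ × ℕ)) : Prop :=
  ∃ i j k : ℕ, L = {(i, j, k), (i + 1, j, k)} ∨ L = {(i, j, k), (i, j + 1, k)} ∨
    L = {(i, j, k), (i, j, k + 1)}

/-- A lozenge tiling of a set `H` of unit triangles: a set of pairwise disjoint lozenges whose
union is `H`. -/
def IsLozengeTiling (H : Set (ℕ × ℕ × ℕ)) (T : Set (Set (ℕ × ℕ × ℕ))) : Prop :=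
  (∀ L ∈ T, IsLozenge L) ∧ T.PairwiseDisjoint id ∧ ⋃₀ T = H

end PuncturedHexagon

namespace PuncturedHexagon

/-! Read the third coordinate of a unit triangle as a height and the second as a position. In a
tiling, the lozenges of the first two types chain into paths that descend one unit of height per
step and keep their position or raise it by `1`; lozenges of the third type fill the rest. `C` paths
start at the corner `w ≥ c`, `M` at the puncture, and all end at height `0`, filling the `C + M`
positions from `A` to `b - 1` (note `A + C + M = b`). Tilings thus correspond to non-intersecting
path families (`ncard_isLozengeTiling`).

The entries of `matrixN` count single paths, so by the Lindström–Gessel–Viennot principle its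
determinant is the signed count of these families. A corner path that passes the puncture on the far
side is inverted with precisely the `M` puncture paths, and there are no other inversions, so the
sign is a power of `(-1) ^ M`. Since `a + b + c = 2 * (s + 2) + M`, an even `a + b + c` makes every
sign `+1` (`det_matrixN_eq_ncard`). An explicit family (`exists_isPathFamily`) gives a tiling for
either parity, and positivity in the even case.

For the Lefschetz property take `ℓ = x + y - z`. Modulo `ℓ` the generators become `x^a`, `y^b`,
`(x+y)^c`, `x^α y^β (x+y)^γ`, and their multiples in degree `s + 1` give a linear system with matrix
`matrixN` for the monomials not killed by `x^a` or `y^b`. If the determinant is nonzero in `K`, then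
`×ℓ` is surjective from degree `s` on. A tiling matches the monomial bases in degrees `s` and `s +
1`, so `×ℓ` is also injective in degree `s`; there is no socle below degree `s`, so injectivity
passes down to all smaller degrees (`hasWLP_amaci`). -/

lemma binom_natCast (n k : ℕ) : binom n (k : ℤ) = n.choose k := by
  simp [binom]

lemma binom_of_neg (n : ℕ) {k : ℤ} (hk : k < 0) : binom n k = 0 := by
  simp [binom, hk]

lemma binom_zero (k : ℤ) : binom 0 k = if k = 0 then 1 else 0 := by
  rcases lt_trichotomy k 0 with hk | rfl | hk
  · rw [binom_of_neg _ hk, if_neg hk.ne]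
  · simp [binom]
  · obtain ⟨m, rfl⟩ := Int.eq_ofNat_of_zero_le hk.le
    obtain ⟨m, rfl⟩ := Nat.exists_eq_succ_of_ne_zero (n := m) (by rintro rfl; simp at hk)
    rw [binom_natCast, if_neg hk.ne']
    simp

lemma binom_succ (n : ℕ) (k : ℤ) : binom (n + 1) k = binom n k + binom n (k - 1) := by
  rcases lt_trichotomy k 0 with hk | rfl | hk
  · rw [binom_of_neg _ hk, binom_of_neg _ hk, binom_of_neg _ (by omega), add_zero]
  · simp [binom]
  · obtain ⟨m, rfl⟩ := Int.eq_ofNat_of_zero_le hk.le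
    obtain ⟨m, rfl⟩ := Nat.exists_eq_succ_of_ne_zero (n := m) (by rintro rfl; simp at hk)
    have : ((m.succ : ℕ) : ℤ) - 1 = (m : ℕ) := by push_cast; ring
    rw [this, binom_natCast, binom_natCast, binom_natCast, Nat.choose_succ_succ]
    push_cast; ring

/-! ### Determinants as signed counts of non-colliding particle families -/

variable {n : ℕ}

/-- The matrix counting, for particles at height `t` and positions `q i` which start moving once
the height has dropped to `h i`, the lattice paths ending in the positions `A + j`. -/
def pathMatrix (A : ℕ) (h : Fin n → ℕ) (t : ℕ) (q : Fin n → ℕ) : Matrix (Fin n) (Fin n) ℤ :=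
  Matrix.of fun i j => binom (min t (h i)) ((A : ℤ) + (j : ℕ) - q i)

/-- The configurations at height `t` that can follow the configuration `q` at height `t + 1`. -/
def nextConfigs (h : Fin n → ℕ) (t : ℕ) (q : Fin n → ℕ) : Finset (Fin n → ℕ) :=
  Fintype.piFinset fun i => if t < h i then {q i, q i + 1} else {q i}

lemma mem_nextConfigs {h : Fin n → ℕ} {t : ℕ} {q q' : Fin n → ℕ} :
    q' ∈ nextConfigs h t q ↔ ∀ i, q' i = q i ∨ (t < h i ∧ q' i = q i + 1) := by
  rw [nextConfigs, Fintype.mem_piFinset]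
  refine forall_congr' fun i => ?_
  split_ifs with hi <;> simp [hi]

/-- No two particles that are moving at height `t` are in the same place. -/
def NonColliding (h : Fin n → ℕ) (t : ℕ) (q : Fin n → ℕ) : Prop :=
  ∀ i j, t ≤ h i → t ≤ h j → q i = q j → i = j

/-- Pascal's rule splits each moving row into the rows for the two possible steps; multilinearity of
the determinant in the rows does the rest. -/
lemma det_pathMatrix_succ (A : ℕ) (h : Fin n → ℕ) (t : ℕ) (q : Fin n → ℕ) :
    (pathMatrix A h (t + 1) q).det = ∑ q' ∈ nextConfigs h t q, (pathMatrix A h t q').det := by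
  have hrow : pathMatrix A h (t + 1) q = fun i =>
      ∑ x ∈ (if t < h i then {q i, q i + 1} else {q i} : Finset ℕ),
        fun j : Fin n => binom (min t (h i)) ((A : ℤ) + (j : ℕ) - x) := by
    ext i j
    simp only [pathMatrix, Matrix.of_apply]
    split_ifs with hi
    · rw [Finset.sum_pair (by simp), min_eq_left (by omega : t + 1 ≤ h i),
        min_eq_left (by omega : t ≤ h i), binom_succ, Pi.add_apply]
      congr 2
      push_cast; ring
    · rw [Finset.sum_singleton, min_eq_right (by omega : h i ≤ t + 1),
        min_eq_right (by omega : h i ≤ t)]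
  rw [hrow]
  exact (Matrix.detRowAlternating (n := Fin n) (R := ℤ)).toMultilinearMap.map_sum_finset _ _

lemma det_pathMatrix_of_not_nonColliding (A : ℕ) {h : Fin n → ℕ} {t : ℕ} {q : Fin n → ℕ}
    (hq : ¬ NonColliding h t q) : (pathMatrix A h t q).det = 0 := by
  simp only [NonColliding, not_forall] at hq
  obtain ⟨i, j, hi, hj, hij, hne⟩ := hq
  refine Matrix.det_zero_of_row_eq hne ?_
  ext k
  simp [pathMatrix, min_eq_left hi, min_eq_left hj, hij]

/-- `p k i` is the position of the particle `i` at height `k`. The particles have the positions `q`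
at all heights from `t` on; below, each moving particle makes steps `0` or `1`, without
collisions. -/
structure IsFamily (h : Fin n → ℕ) (t : ℕ) (q : Fin n → ℕ) (p : ℕ → Fin n → ℕ) : Prop where
  top : ∀ k, t ≤ k → p k = q
  step : ∀ k < t, ∀ i, p k i = p (k + 1) i ∨ (k < h i ∧ p k i = p (k + 1) i + 1)
  nonColliding : ∀ k < t, NonColliding h k (p k)

lemma IsFamily.truncate {h : Fin n → ℕ} {t : ℕ} {q : Fin n → ℕ} {p : ℕ → Fin n → ℕ}
    (hp : IsFamily h (t + 1) q p) : IsFamily h t (p t) fun k => p (min k t) where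
  top k hk := by simp only [min_eq_right hk]
  step k hk := by
    simp only [min_eq_left hk.le, min_eq_left (show k + 1 ≤ t from hk)]
    exact hp.step k (by omega)
  nonColliding k hk := by
    simp only [min_eq_left hk.le]
    exact hp.nonColliding k (by omega)

lemma IsFamily.extend {h : Fin n → ℕ} {t : ℕ} {q q' : Fin n → ℕ} {p : ℕ → Fin n → ℕ}
    (hp : IsFamily h t q' p) (hq : q' ∈ nextConfigs h t q) (hq' : NonColliding h t q') :
    IsFamily h (t + 1) q fun k => if k ≤ t then p k else q where
  top k hk := if_neg (by omega)
  step k hk := by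
    rw [mem_nextConfigs] at hq
    rcases (show k < t ∨ k = t by omega) with hk | rfl
    · simp only [if_pos hk.le, if_pos (show k + 1 ≤ t from hk)]
      exact hp.step k hk
    · simpa [hp.top k le_rfl] using hq
  nonColliding k hk := by
    rcases (show k < t ∨ k = t by omega) with hk | rfl
    · simp only [if_pos hk.le]
      exact hp.nonColliding k hk
    · simpa [hp.top k le_rfl] using hq'

/-- Iterating the row expansion and dropping colliding configurations, whose matrices have two equal
rows, leaves exactly the non-colliding families. This replaces the usual path-swapping involution.
-/
lemma exists_finset_isFamily (A : ℕ) (h : Fin n → ℕ) (t : ℕ) (q : Fin n → ℕ) :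
    ∃ F : Finset (ℕ → Fin n → ℕ), (∀ p, p ∈ F ↔ IsFamily h t q p) ∧
      (pathMatrix A h t q).det = ∑ p ∈ F, (pathMatrix A h 0 (p 0)).det := by
  classical
  induction t generalizing q with
  | zero =>
    refine ⟨{fun _ => q}, fun p => ?_, by simp⟩
    rw [Finset.mem_singleton]
    refine ⟨?_, fun hp => funext fun k => hp.top k (Nat.zero_le k)⟩
    rintro rfl
    exact ⟨fun _ _ => rfl, fun k hk => by omega, fun k hk => by omega⟩
  | succ t ih =>
    choose F hF hdet using ih
    let ext : (ℕ → Fin n → ℕ) → ℕ → Fin n → ℕ := fun p k => if k ≤ t then p k else q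
    -- The extension overwrites only the values above `t`, and those are all equal to the value at
    -- `t`.
    have hext : ∀ {q₁ q₂ p₁ p₂}, IsFamily h t q₁ p₁ → IsFamily h t q₂ p₂ → ext p₁ = ext p₂ →
        p₁ = p₂ := by
      intro q₁ q₂ p₁ p₂ h₁ h₂ he
      have hle : ∀ k ≤ t, p₁ k = p₂ k := fun k hk => by
        simpa [ext, hk] using congrFun he k
      funext k
      rcases le_total k t with hk | hk
      · exact hle k hk
      · rw [h₁.top k hk, h₂.top k hk, ← h₁.top t le_rfl, ← h₂.top t le_rfl, hle t le_rfl]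
    refine ⟨((nextConfigs h t q).filter (NonColliding h t)).biUnion fun q' => (F q').image ext,
      fun p => ?_, ?_⟩
    · simp only [Finset.mem_biUnion, Finset.mem_filter, Finset.mem_image]
      constructor
      · rintro ⟨q', ⟨hq, hq'⟩, p', hp', rfl⟩
        exact ((hF _ _).1 hp').extend hq hq'
      · intro hp
        refine ⟨p t, ⟨mem_nextConfigs.2 ?_, hp.nonColliding t (by omega)⟩, _,
          (hF _ _).2 hp.truncate, ?_⟩
        · have := hp.step t (by omega)
          rwa [hp.top (t + 1) le_rfl] at this
        · funext k
          by_cases hk : k ≤ t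
          · simp [ext, hk]
          · simp only [ext, hk, if_false]
            exact (hp.top k (by omega)).symm
    · rw [Finset.sum_biUnion, det_pathMatrix_succ, Finset.sum_filter]
      · refine Finset.sum_congr rfl fun q' _ => ?_
        split_ifs with hq'
        · rw [Finset.sum_image fun p₁ h₁ p₂ h₂ he => hext ((hF _ _).1 h₁) ((hF _ _).1 h₂) he,
            hdet]
          simp [ext]
        · exact det_pathMatrix_of_not_nonColliding A hq'
      · intro q₁ _ q₂ _ hne
        rw [Function.onFun, Finset.disjoint_left]
        intro p h₁ h₂
        rw [Finset.mem_image] at h₁ h₂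
        obtain ⟨p₁, h₁, rfl⟩ := h₁
        obtain ⟨p₂, h₂, he⟩ := h₂
        rw [hF] at h₁ h₂
        obtain rfl := hext h₂ h₁ he
        exact hne ((h₁.top t le_rfl).symm.trans (h₂.top t le_rfl))

lemma det_pathMatrix_zero_eq_zero {A : ℕ} {h q : Fin n → ℕ} {i : Fin n}
    (hi : ¬ (A ≤ q i ∧ q i < A + n)) : (pathMatrix A h 0 q).det = 0 := by
  refine Matrix.det_eq_zero_of_row_eq_zero i fun j => ?_
  have := j.2
  simp only [pathMatrix, Matrix.of_apply, Nat.zero_min, binom_zero]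
  exact if_neg (by omega)

/-- With no steps left, each row is a unit vector. -/
lemma det_pathMatrix_zero_eq_sign {A : ℕ} {h q : Fin n → ℕ} (σ : Equiv.Perm (Fin n))
    (hσ : ∀ i, q i = A + σ i) : (pathMatrix A h 0 q).det = (Equiv.Perm.sign σ : ℤ) := by
  refine Eq.trans ?_ (Matrix.det_permutation (R := ℤ) σ)
  congr 1
  ext i j
  simp only [pathMatrix, Matrix.of_apply, Nat.zero_min, binom_zero, hσ,
    PEquiv.toMatrix_apply, Equiv.toPEquiv_apply, Option.mem_some_iff, Fin.ext_iff]
  congr 1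
  rw [eq_iff_iff]
  push_cast
  omega

end PuncturedHexagon

/-! ### Path families of the punctured hexagon and their signs -/

namespace PuncturedHexagon

/-- The numerical hypotheses on a punctured hexagon. -/
structure Admissible (a b c α β γ s A B C M : ℕ) : Prop where
  hα : α < a
  hβ : β < b
  hγ : γ < c
  hαβ : ¬ (α = 0 ∧ β = 0)
  hαγ : ¬ (α = 0 ∧ γ = 0)
  hβγ : ¬ (β = 0 ∧ γ = 0)
  hs : a + b + c + α + β + γ = 3 * (s + 2)
  hA : a + A = s + 2
  hB : b + B = s + 2
  hC : c + C = s + 2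
  hM : α + β + γ + M = s + 2
  hA' : A ≤ β + γ
  hB' : B ≤ α + γ
  hC' : C ≤ α + β

/-- The height at which a particle starts to move. -/
def height (C M c γ : ℕ) (r : Fin (C + M)) : ℕ := if (r : ℕ) < C then c else γ

/-- The starting position of a particle. -/
def source (C M β : ℕ) (r : Fin (C + M)) : ℕ := if (r : ℕ) < C then r else β + (r - C)

/-- The families of particle paths that start at the removed corner `w ≥ c` and at the puncture
and end at the bottom of the punctured hexagon. -/
structure IsPathFamily (A C M c β γ : ℕ) (p : ℕ → Fin (C + M) → ℕ) : Prop
    extends IsFamily (height C M c γ) c (source C M β) p where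
  bottom : ∀ r, A ≤ p 0 r ∧ p 0 r < A + (C + M)

section steps

variable {n : ℕ} {h q : Fin n → ℕ} {t : ℕ} {p : ℕ → Fin n → ℕ}

lemma IsFamily.step_le (hp : IsFamily h t q p) (k : ℕ) (i : Fin n) :
    p (k + 1) i ≤ p k i ∧ p k i ≤ p (k + 1) i + 1 ∧ (h i ≤ k → p k i = p (k + 1) i) := by
  by_cases hk : k < t
  · have := hp.step k hk i
    omega
  · rw [hp.top k (by omega), hp.top (k + 1) (by omega)]
    omega

lemma IsFamily.le_add (hp : IsFamily h t q p) (k d : ℕ) (i : Fin n) :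
    p (k + d) i ≤ p k i ∧ p k i ≤ p (k + d) i + d := by
  induction d with
  | zero => simp
  | succ d ih =>
    have := hp.step_le (k + d) i
    rw [← add_assoc]
    omega

lemma IsFamily.bounds (hp : IsFamily h t q p) {k k' : ℕ} (hk : k ≤ k') (i : Fin n) :
    p k' i ≤ p k i ∧ p k i ≤ p k' i + (k' - k) := by
  obtain ⟨d, rfl⟩ := Nat.exists_eq_add_of_le hk
  have := hp.le_add k d i
  omega

lemma IsFamily.eq_of_height_le (hp : IsFamily h t q p) {k : ℕ} (i : Fin n) (hk : h i ≤ k) :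
    p k i = q i := by
  have key : ∀ d, p (h i + d) i = p (h i) i := fun d => by
    induction d with
    | zero => rfl
    | succ d ih => rw [← ih, ← add_assoc, (hp.step_le (h i + d) i).2.2 (by omega)]
  obtain ⟨d, rfl⟩ := Nat.exists_eq_add_of_le hk
  rw [key, ← key t, hp.top _ (by omega)]

/-- Steps have size `0` or `1`, so particles that are both moving cannot change order without
meeting. -/
lemma IsFamily.lt_of_lt (hp : IsFamily h t q p) {k m : ℕ} (hkm : k ≤ m) (hmt : m ≤ t) {i j : Fin n}
    (hi : m ≤ h i) (hj : m ≤ h j) (hij : p m i < p m j) : p k i < p k j := by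
  induction hkm using Nat.decreasingInduction with
  | self => exact hij
  | of_succ k hk ih =>
    have h1 := hp.step_le k i
    have h2 := hp.step_le k j
    have h3 : p k i ≠ p k j := fun he => by
      have := hp.nonColliding k (by omega) i j (by omega) (by omega) he
      subst this
      exact lt_irrefl _ hij
    omega

end steps

variable {a b c α β γ s A B C M : ℕ} {p : ℕ → Fin (C + M) → ℕ}

lemma height_of_lt {r : Fin (C + M)} (hr : (r : ℕ) < C) : height C M c γ r = c := if_pos hr
lemma height_of_ge {r : Fin (C + M)} (hr : C ≤ (r : ℕ)) : height C M c γ r = γ :=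
  if_neg (by omega)
lemma source_of_lt {r : Fin (C + M)} (hr : (r : ℕ) < C) : source C M β r = r := if_pos hr
lemma source_of_ge {r : Fin (C + M)} (hr : C ≤ (r : ℕ)) : source C M β r = β + (r - C) :=
  if_neg (by omega)

lemma matrixN_eq_pathMatrix (hγ : γ ≤ c) :
    matrixN A C M c β γ = pathMatrix A (height C M c γ) c (source C M β) := by
  ext i j
  simp only [matrixN, pathMatrix, Matrix.of_apply, height, source]
  split_ifs with hi
  · simp
  · rw [min_eq_right hγ, Nat.cast_add, Nat.cast_sub (by omega)]
    congr 1
    ring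

lemma IsPathFamily.bottom_injective (hp : IsPathFamily A C M c β γ p) (hc : 0 < c) :
    Function.Injective (p 0) := fun _ _ he =>
  hp.nonColliding 0 hc _ _ (Nat.zero_le _) (Nat.zero_le _) he

lemma IsPathFamily.exists_perm (hp : IsPathFamily A C M c β γ p) (hc : 0 < c) :
    ∃ σ : Equiv.Perm (Fin (C + M)), ∀ r, p 0 r = A + σ r := by
  have hb := hp.bottom
  let f : Fin (C + M) → Fin (C + M) := fun r => ⟨p 0 r - A, by have := hb r; omega⟩
  have hf : Function.Injective f := fun r r' he => by
    have h1 := hb r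
    have h2 := hb r'
    have : p 0 r - A = p 0 r' - A := congrArg Fin.val he
    exact hp.bottom_injective hc (by omega)
  refine ⟨Equiv.ofBijective f (Finite.injective_iff_bijective.1 hf), fun r => ?_⟩
  have h1 := hb r
  simp only [Equiv.ofBijective_apply, f]
  omega

/-- A path from the corner passes the puncture on one side. -/
lemma IsPathFamily.notMem_puncture (hp : IsPathFamily A C M c β γ p) (hγ : γ < c)
    {r : Fin (C + M)} (hr : (r : ℕ) < C) : p γ r < β ∨ β + M ≤ p γ r := by
  by_contra! hcon
  have hr' : C ≤ ((⟨C + (p γ r - β), by omega⟩ : Fin (C + M)) : ℕ) := by simp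
  have := hp.nonColliding γ hγ r ⟨C + (p γ r - β), by omega⟩ (by rw [height_of_lt hr]; omega)
    (by rw [height_of_ge hr']) (by
      rw [hp.eq_of_height_le _ (height_of_ge hr').le, source_of_ge hr']
      simp only
      omega)
  rw [this] at hr
  simp at hr

/-- The second alternative is the only possible source of inversions: a corner path passing the
puncture on the far side, compared with a puncture path. -/
lemma IsPathFamily.bottom_lt (hp : IsPathFamily A C M c β γ p) (hγ : γ < c) {r r' : Fin (C + M)}
    (hrr : r < r') :
    p 0 r < p 0 r' ∨ ((r : ℕ) < C ∧ C ≤ (r' : ℕ) ∧ β + M ≤ p γ r) := by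
  rcases lt_or_ge (r' : ℕ) C with h | h
  · have hr : (r : ℕ) < C := lt_trans hrr h
    left
    refine hp.lt_of_lt (Nat.zero_le c) le_rfl (height_of_lt hr).ge (height_of_lt h).ge ?_
    rw [hp.top c le_rfl, source_of_lt hr, source_of_lt h]
    exact hrr
  · rcases lt_or_ge (r : ℕ) C with hr | hr
    · rcases hp.notMem_puncture hγ hr with h1 | h1
      · left
        refine hp.lt_of_lt (Nat.zero_le γ) hγ.le (by rw [height_of_lt hr]; omega)
          (height_of_ge h).ge ?_
        rw [hp.eq_of_height_le r' (height_of_ge h).le, source_of_ge h]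
        omega
      · exact Or.inr ⟨hr, h, h1⟩
    · left
      refine hp.lt_of_lt (Nat.zero_le γ) hγ.le (height_of_ge hr).ge (height_of_ge h).ge ?_
      rw [hp.eq_of_height_le r' (height_of_ge h).le, source_of_ge h,
        hp.eq_of_height_le r (height_of_ge hr).le, source_of_ge hr]
      have : (r : ℕ) < r' := hrr
      omega

lemma IsPathFamily.bottom_gt (hp : IsPathFamily A C M c β γ p) (hγ : γ < c) {r r' : Fin (C + M)}
    (hr : (r : ℕ) < C) (hr' : C ≤ (r' : ℕ)) (h : β + M ≤ p γ r) : p 0 r' < p 0 r := by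
  refine hp.lt_of_lt (Nat.zero_le γ) hγ.le (height_of_ge hr').ge (by rw [height_of_lt hr]; omega) ?_
  rw [hp.eq_of_height_le r' (height_of_ge hr').le, source_of_ge hr']
  omega

/-- Each corner path beyond the puncture contributes `M` inversions, an even number; other indices
contribute none. -/
lemma IsPathFamily.sign_eq_one (hp : IsPathFamily A C M c β γ p) (hγ : γ < c) (hM : Even M)
    {σ : Equiv.Perm (Fin (C + M))} (hσ : ∀ r, p 0 r = A + σ r) : Equiv.Perm.sign σ = 1 := by
  have hlt : ∀ r r', σ r < σ r' ↔ p 0 r < p 0 r' := fun r r' => by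
    rw [hσ, hσ, Fin.lt_def]
    omega
  rw [Equiv.Perm.sign_eq_prod_prod_Ioi]
  refine Finset.prod_eq_one fun r _ => ?_
  by_cases hr : (r : ℕ) < C ∧ β + M ≤ p γ r
  · have key : ∀ r' ∈ Finset.Ioi r, (if σ r < σ r' then (1 : ℤˣ) else -1) =
        if C ≤ (r' : ℕ) then -1 else 1 := by
      intro r' hr'
      rw [Finset.mem_Ioi] at hr'
      split_ifs with h1 h2 h2
      · have := hp.bottom_gt hγ hr.1 h2 hr.2
        rw [hlt] at h1
        omega
      · rfl
      · rfl
      · rw [hlt] at h1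
        have := hp.bottom_lt hγ hr'
        omega
    rw [Finset.prod_congr rfl key, Finset.prod_ite, Finset.prod_const, Finset.prod_const_one,
      mul_one]
    have hcard : ((Finset.Ioi r).filter fun r' : Fin (C + M) => C ≤ (r' : ℕ)).card = M := by
      have : ((Finset.Ioi r).filter fun r' : Fin (C + M) => C ≤ (r' : ℕ)) =
          Finset.univ.map (Fin.natAddEmb C) := by
        ext r'
        simp only [Finset.mem_filter, Finset.mem_Ioi, Finset.mem_map, Finset.mem_univ, true_and,
          Fin.natAddEmb_apply, Fin.lt_def]
        constructor
        · rintro ⟨-, h⟩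
          exact ⟨⟨r' - C, by omega⟩, Fin.ext (by simp; omega)⟩
        · rintro ⟨m, rfl⟩
          simp
          omega
      rw [this, Finset.card_map, Finset.card_univ, Fintype.card_fin]
    rw [hcard, hM.neg_one_pow]
  · refine Finset.prod_eq_one fun r' hr' => ?_
    rw [Finset.mem_Ioi] at hr'
    rw [if_pos]
    rw [hlt]
    have := hp.bottom_lt hγ hr'
    omega

theorem det_matrixN_eq_ncard (hγ : γ < c) (hM : Even M) :
    (matrixN A C M c β γ).det = {p | IsPathFamily A C M c β γ p}.ncard := by
  classical
  obtain ⟨F, hF, hdet⟩ := exists_finset_isFamily A (height C M c γ) c (source C M β)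
  have hset : {p | IsPathFamily A C M c β γ p} =
      ↑(F.filter fun p => ∀ r, A ≤ p 0 r ∧ p 0 r < A + (C + M)) := by
    ext p
    simp only [Set.mem_ofPred_eq, Finset.coe_filter, hF]
    exact ⟨fun h => ⟨h.1, h.2⟩, fun h => ⟨h.1, h.2⟩⟩
  rw [matrixN_eq_pathMatrix hγ.le, hdet, hset, Set.ncard_coe_finset, Finset.card_filter,
    Nat.cast_sum]
  refine Finset.sum_congr rfl fun p hp => ?_
  rw [hF] at hp
  split_ifs with hb
  · have hp' : IsPathFamily A C M c β γ p := ⟨hp, hb⟩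
    obtain ⟨σ, hσ⟩ := hp'.exists_perm (by omega)
    rw [det_pathMatrix_zero_eq_sign σ hσ, hp'.sign_eq_one hγ hM hσ]
    rfl
  · rw [not_forall] at hb
    obtain ⟨r, hr⟩ := hb
    rw [det_pathMatrix_zero_eq_zero hr]
    rfl

lemma finite_isPathFamily : {p | IsPathFamily A C M c β γ p}.Finite := by
  obtain ⟨F, hF, -⟩ := exists_finset_isFamily A (height C M c γ) c (source C M β)
  exact F.finite_toSet.subset fun p hp => (hF p).2 hp.1

end PuncturedHexagon

/-! ### Lozenge tilings as perfect matchings of unit triangles -/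

namespace PuncturedHexagon

variable {a b c α β γ s A B C M : ℕ} {p : ℕ → Fin (C + M) → ℕ}

/-- The unit triangle `u` shares an edge with `d` and has the opposite orientation. -/
def Covers (d u : ℕ × ℕ × ℕ) : Prop :=
  u = (d.1 + 1, d.2.1, d.2.2) ∨ u = (d.1, d.2.1 + 1, d.2.2) ∨ u = (d.1, d.2.1, d.2.2 + 1)

/-- The degree of the monomial recording a unit triangle. -/
def deg (t : ℕ × ℕ × ℕ) : ℕ := t.1 + t.2.1 + t.2.2

lemma Covers.deg_eq {d u : ℕ × ℕ × ℕ} (h : Covers d u) : deg u = deg d + 1 := by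
  rcases h with rfl | rfl | rfl <;> simp only [deg] <;> omega

lemma isLozenge_iff {L : Set (ℕ × ℕ × ℕ)} : IsLozenge L ↔ ∃ d u, Covers d u ∧ L = {d, u} := by
  constructor
  · rintro ⟨i, j, k, h | h | h⟩
    · exact ⟨(i, j, k), _, Or.inl rfl, h⟩
    · exact ⟨(i, j, k), _, Or.inr (Or.inl rfl), h⟩
    · exact ⟨(i, j, k), _, Or.inr (Or.inr rfl), h⟩
  · rintro ⟨⟨i, j, k⟩, u, h | h | h, rfl⟩
    · exact ⟨i, j, k, Or.inl (by rw [h])⟩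
    · exact ⟨i, j, k, Or.inr (Or.inl (by rw [h]))⟩
    · exact ⟨i, j, k, Or.inr (Or.inr (by rw [h]))⟩

lemma pair_inj {d u d' u' : ℕ × ℕ × ℕ} (h : deg u = deg d + 1) (h' : deg u' = deg d' + 1)
    (he : ({d, u} : Set (ℕ × ℕ × ℕ)) = {d', u'}) : d = d' ∧ u = u' := by
  rcases Set.pair_eq_pair_iff.1 he with h1 | ⟨rfl, rfl⟩
  · exact h1
  · omega

section tiling

variable {T : Set (Set (ℕ × ℕ × ℕ))}

lemma IsLozengeTiling.exists_of_mem (hT : IsLozengeTiling (region s a b c α β γ) T)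
    {t : ℕ × ℕ × ℕ} (ht : t ∈ region s a b c α β γ) :
    ∃ d u, Covers d u ∧ deg d = s ∧ d ∈ region s a b c α β γ ∧ u ∈ region s a b c α β γ ∧
      {d, u} ∈ T ∧ (t = d ∨ t = u) := by
  rw [← hT.2.2] at ht
  obtain ⟨L, hL, htL⟩ := ht
  obtain ⟨d, u, hdu, rfl⟩ := isLozenge_iff.1 (hT.1 L hL)
  have hd : d ∈ region s a b c α β γ := hT.2.2 ▸ ⟨_, hL, Or.inl rfl⟩
  have hu : u ∈ region s a b c α β γ := hT.2.2 ▸ ⟨_, hL, Or.inr rfl⟩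
  refine ⟨d, u, hdu, ?_, hd, hu, hL, htL⟩
  have h1 := hdu.deg_eq
  have h2 := hd.1
  have h3 := hu.1
  simp only [deg] at *
  omega

lemma IsLozengeTiling.exists_up (hT : IsLozengeTiling (region s a b c α β γ) T)
    {d : ℕ × ℕ × ℕ} (hd : d ∈ region s a b c α β γ) (hds : deg d = s) :
    ∃ u, Covers d u ∧ u ∈ region s a b c α β γ ∧ {d, u} ∈ T := by
  obtain ⟨d', u, h1, h2, -, h4, h5, rfl | rfl⟩ := hT.exists_of_mem hd
  · exact ⟨u, h1, h4, h5⟩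
  · have := h1.deg_eq
    omega

lemma IsLozengeTiling.exists_down (hT : IsLozengeTiling (region s a b c α β γ) T)
    {u : ℕ × ℕ × ℕ} (hu : u ∈ region s a b c α β γ) (hus : deg u = s + 1) :
    ∃ d, Covers d u ∧ deg d = s ∧ d ∈ region s a b c α β γ ∧ {d, u} ∈ T := by
  obtain ⟨d, u', h1, h2, h3, -, h5, rfl | rfl⟩ := hT.exists_of_mem hu
  · omega
  · exact ⟨d, h1, h2, h3, h5⟩

lemma IsLozengeTiling.mem_region {H : Set (ℕ × ℕ × ℕ)} (hT : IsLozengeTiling H T)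
    {d u : ℕ × ℕ × ℕ} (h : {d, u} ∈ T) : d ∈ H ∧ u ∈ H :=
  hT.2.2 ▸ ⟨⟨_, h, Or.inl rfl⟩, ⟨_, h, Or.inr rfl⟩⟩

lemma IsLozengeTiling.unique {H : Set (ℕ × ℕ × ℕ)} (hT : IsLozengeTiling H T)
    {d u d' u' : ℕ × ℕ × ℕ} (hdu : deg u = deg d + 1) (hdu' : deg u' = deg d' + 1)
    (h : {d, u} ∈ T) (h' : {d', u'} ∈ T) (he : d = d' ∨ u = u') : d = d' ∧ u = u' := by
  refine pair_inj hdu hdu' ?_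
  by_contra hne
  have := hT.2.1 h h' hne
  rw [Function.onFun, id, id, Set.disjoint_left] at this
  rcases he with rfl | rfl
  · exact this (Or.inl rfl) (Or.inl rfl)
  · exact this (Or.inr rfl) (Or.inr rfl)

/-- Reduces the comparison of two tilings to a single inclusion. -/
lemma IsLozengeTiling.eq_of_subset {H : Set (ℕ × ℕ × ℕ)} {T' : Set (Set (ℕ × ℕ × ℕ))}
    (hT : IsLozengeTiling H T) (hT' : IsLozengeTiling H T') (h : T' ⊆ T) : T' = T := by
  refine h.antisymm fun L hL => ?_
  obtain ⟨d, u, -, rfl⟩ := isLozenge_iff.1 (hT.1 L hL)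
  have hd := (hT.mem_region hL).1
  rw [← hT'.2.2] at hd
  obtain ⟨L', hL', hdL⟩ := hd
  by_contra hn
  have hne : L' ≠ {d, u} := fun he => hn (he ▸ hL')
  exact (Set.disjoint_left.1 (hT.2.1 (h hL') hL hne)) hdL (Or.inl rfl)

/-- A perfect matching of the unit triangles gives a lozenge tiling. -/
lemma isLozengeTiling_of_bijOn {f : ℕ × ℕ × ℕ → ℕ × ℕ × ℕ} (hf : ∀ d, Covers d (f d))
    (hbij : Set.BijOn f {d | d ∈ region s a b c α β γ ∧ deg d = s}
      {u | u ∈ region s a b c α β γ ∧ deg u = s + 1}) :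
    IsLozengeTiling (region s a b c α β γ)
      ((fun d => {d, f d}) '' {d | d ∈ region s a b c α β γ ∧ deg d = s}) := by
  refine ⟨?_, ?_, ?_⟩
  · rintro _ ⟨d, -, rfl⟩
    exact isLozenge_iff.2 ⟨d, f d, hf d, rfl⟩
  · rintro _ ⟨d, hd, rfl⟩ _ ⟨d', hd', rfl⟩ hne
    rw [Function.onFun, id, id, Set.disjoint_left]
    rintro t (rfl | rfl) (h | h)
    · subst h
      exact hne rfl
    · have h1 := (hf d').deg_eq
      have h2 := hd.2
      have h3 := hd'.2
      rw [h] at h2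
      omega
    · have h1 := (hf d).deg_eq
      have h2 := hd.2
      have h3 := hd'.2
      rw [← h] at h3
      omega
    · have := hbij.injOn hd hd' h
      subst this
      exact hne rfl
  · ext t
    constructor
    · rintro ⟨_, ⟨d, hd, rfl⟩, rfl | rfl⟩
      · exact hd.1
      · exact (hbij.mapsTo hd).1
    · intro ht
      rcases ht.1 with h | h
      · exact ⟨_, ⟨t, ⟨ht, h⟩, rfl⟩, Or.inl rfl⟩
      · obtain ⟨d, hd, rfl⟩ := hbij.surjOn ⟨ht, h⟩
        exact ⟨_, ⟨d, hd, rfl⟩, Or.inr rfl⟩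

end tiling

/-! ### From path families to tilings -/

open Classical in
/-- The partner of a downward unit triangle: particles move along the lozenges of the first two
types, and the third type is used where there is no particle. -/
noncomputable def partner (h : Fin (C + M) → ℕ) (p : ℕ → Fin (C + M) → ℕ) (d : ℕ × ℕ × ℕ) :
    ℕ × ℕ × ℕ :=
  if ∃ r, d.2.2 < h r ∧ p (d.2.2 + 1) r = d.2.1 then
    if ∃ r, d.2.2 < h r ∧ p (d.2.2 + 1) r = d.2.1 ∧ p d.2.2 r = d.2.1 + 1 then
      (d.1, d.2.1 + 1, d.2.2)
    else (d.1 + 1, d.2.1, d.2.2)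
  else (d.1, d.2.1, d.2.2 + 1)

lemma covers_partner (h : Fin (C + M) → ℕ) (p : ℕ → Fin (C + M) → ℕ) (d : ℕ × ℕ × ℕ) :
    Covers d (partner h p d) := by
  unfold partner Covers
  split_ifs
  · exact Or.inr (Or.inl rfl)
  · exact Or.inl rfl
  · exact Or.inr (Or.inr rfl)

/-- `IsFamily` forbids collisions only below height `c`; at height `c` itself the moving particles
are at their distinct sources. -/
lemma IsPathFamily.unique (hp : IsPathFamily A C M c β γ p) (hγ : γ < c) {k : ℕ}
    {r r' : Fin (C + M)} (hr : k < height C M c γ r) (hr' : k < height C M c γ r')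
    (he : p (k + 1) r = p (k + 1) r') : r = r' := by
  have hle : ∀ r : Fin (C + M), height C M c γ r ≤ c := fun r => by
    unfold height; split_ifs <;> omega
  rcases (show k + 1 < c ∨ k + 1 = c by have := hle r; omega) with h | h
  · exact hp.nonColliding (k + 1) h r r' hr hr' he
  · have hlt : ∀ r : Fin (C + M), k < height C M c γ r → (r : ℕ) < C := fun r hr => by
      unfold height at hr; split_ifs at hr <;> omega
    rw [hp.top (k + 1) h.ge, source_of_lt (hlt r hr), source_of_lt (hlt r' hr')] at he
    exact Fin.ext he

lemma partner_eq_of_step (hp : IsPathFamily A C M c β γ p) (hγ : γ < c) {i k : ℕ}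
    {r : Fin (C + M)} (hr : k < height C M c γ r) :
    (p k r = p (k + 1) r ∧
      partner (height C M c γ) p (i, p (k + 1) r, k) = (i + 1, p k r, k)) ∨
    (p k r = p (k + 1) r + 1 ∧
      partner (height C M c γ) p (i, p (k + 1) r, k) = (i, p k r, k)) := by
  have hst := hp.step_le k r
  have hex : ∃ r', k < height C M c γ r' ∧ p (k + 1) r' = p (k + 1) r := ⟨r, hr, rfl⟩
  unfold partner
  simp only [if_pos hex]
  rcases (show p k r = p (k + 1) r ∨ p k r = p (k + 1) r + 1 by omega) with h | h
  · left
    refine ⟨h, ?_⟩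
    rw [if_neg, h]
    rintro ⟨r', h1, h2, h3⟩
    obtain rfl := hp.unique hγ hr h1 h2.symm
    omega
  · right
    refine ⟨h, ?_⟩
    rw [if_pos ⟨r, hr, rfl, h⟩, h]

lemma partner_eq_of_not {h : Fin (C + M) → ℕ} {d : ℕ × ℕ × ℕ}
    (hd : ¬ ∃ r, d.2.2 < h r ∧ p (d.2.2 + 1) r = d.2.1) :
    partner h p d = (d.1, d.2.1, d.2.2 + 1) := by
  unfold partner
  rw [if_neg hd]

lemma IsPathFamily.exists_bottom (hp : IsPathFamily A C M c β γ p) (hc : 0 < c) {j : ℕ}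
    (hj : A ≤ j) (hj' : j < A + (C + M)) : ∃ r, p 0 r = j := by
  obtain ⟨σ, hσ⟩ := hp.exists_perm hc
  refine ⟨σ.symm ⟨j - A, by omega⟩, ?_⟩
  rw [hσ, Equiv.apply_symm_apply]
  simp only
  omega

/-- The particles stay within the big triangle and the two lower corners, and avoid the puncture. -/
lemma IsPathFamily.mem_region (hp : IsPathFamily A C M c β γ p)
    (H : Admissible a b c α β γ s A B C M) {k : ℕ} {r : Fin (C + M)}
    (hr : k < height C M c γ r) : ∃ i, i + p k r + k = s + 1 ∧ (i, p k r, k) ∈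
      region s a b c α β γ ∧ p (k + 1) r + k ≤ s := by
  obtain ⟨hα, hβ, hγ, -, -, -, hs, hA, hB, hC, hM, hA', hB', hC'⟩ := H
  have hrlt := r.2
  have h0 := hp.bottom r
  have h1 := hp.bounds (Nat.zero_le k) r
  have h2 := hp.bounds hr.le r
  have h2' := hp.bounds (show k + 1 ≤ _ from hr) r
  rw [hp.eq_of_height_le r le_rfl] at h2 h2'
  rcases lt_or_ge (r : ℕ) C with hrC | hrC
  · rw [height_of_lt hrC] at hr h2 h2'
    rw [source_of_lt hrC] at h2 h2'
    -- The bounds on the first two entries come from the bottom: `p k r + k ≥ A` and `p k r < A + C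
    -- + M = b`.
    refine ⟨s + 1 - k - p k r, by omega, ⟨by simp only; omega, by simp only; omega,
      by simp only; omega, by simp only; omega, ?_⟩, by omega⟩
    simp only
    -- A path inside the puncture would reach height `γ` at a position in `[β, β + M)`, where the
    -- puncture particles start.
    rintro ⟨g1, g2, g3⟩
    have h3 := hp.bounds g3 r
    have h4 := hp.notMem_puncture hγ hrC
    omega
  · rw [height_of_ge hrC] at hr h2 h2'
    rw [source_of_ge hrC] at h2 h2'
    exact ⟨s + 1 - k - p k r, by omega, ⟨by simp only; omega, by simp only; omega,
      by simp only; omega, by simp only; omega, by simp only; omega⟩, by omega⟩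

/-- Below a particle, the partner is the triangle where the particle arrives, and non-collision
makes this injective. Elsewhere the partner lies directly above, which is possible because every
triangle bordering the corner or the puncture from below carries a starting particle. -/
lemma IsPathFamily.bijOn_partner (hp : IsPathFamily A C M c β γ p)
    (H : Admissible a b c α β γ s A B C M) :
    Set.BijOn (partner (height C M c γ) p) {d | d ∈ region s a b c α β γ ∧ deg d = s}
      {u | u ∈ region s a b c α β γ ∧ deg u = s + 1} := by
  have hγ := H.hγ
  refine ⟨?_, ?_, ?_⟩
  · rintro ⟨i, j, k⟩ ⟨hd, hds⟩
    have hdeg : deg (partner (height C M c γ) p (i, j, k)) = s + 1 := by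
      rw [(covers_partner _ p (i, j, k)).deg_eq, hds]
    refine ⟨?_, hdeg⟩
    by_cases hex : ∃ r, k < height C M c γ r ∧ p (k + 1) r = j
    · obtain ⟨r, hr, rfl⟩ := hex
      obtain ⟨i', hi', hmem, -⟩ := hp.mem_region H hr
      rcases partner_eq_of_step hp hγ (i := i) hr with ⟨-, h⟩ | ⟨-, h⟩ <;> rw [h] at hdeg ⊢ <;>
        simp only [deg] at hdeg
      · rwa [show i + 1 = i' by omega]
      · rwa [show i = i' by omega]
    · rw [partner_eq_of_not hex] at hdeg ⊢
      obtain ⟨-, h1, h2, h3, h4⟩ := hd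
      simp only [deg] at hdeg h1 h2 h3 h4 hds ⊢
      obtain ⟨hα, hβ, hγ, -, -, -, hs, hA, hB, hC, hM, hA', hB', hC'⟩ := H
      refine ⟨Or.inr hdeg, h1, h2, ?_, ?_⟩
      · simp only
        by_contra hk
        refine hex ⟨⟨j, by omega⟩, ?_, ?_⟩
        · rw [height_of_lt (by simp only; omega)]
          exact h3
        · rw [hp.top _ (by omega), source_of_lt (by simp only; omega)]
      · simp only
        rintro ⟨g1, g2, g3⟩
        have hC1 : C ≤ ((⟨C + (j - β), by omega⟩ : Fin (C + M)) : ℕ) := by simp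
        refine hex ⟨⟨C + (j - β), by omega⟩, ?_, ?_⟩
        · rw [height_of_ge hC1]
          omega
        · rw [hp.eq_of_height_le _ (by rw [height_of_ge hC1]; omega), source_of_ge hC1]
          simp only
          omega
  · rintro ⟨i, j, k⟩ ⟨hd, hds⟩ ⟨i', j', k'⟩ ⟨hd', hds'⟩ he
    simp only [deg] at hds hds'
    by_cases hex : ∃ r, k < height C M c γ r ∧ p (k + 1) r = j
    · obtain ⟨r, hr, rfl⟩ := hex
      have h1 : (partner (height C M c γ) p (i, p (k + 1) r, k)).2 = (p k r, k) := by
        rcases partner_eq_of_step hp hγ (i := i) hr with ⟨-, h⟩ | ⟨-, h⟩ <;> rw [h]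
      by_cases hex' : ∃ r, k' < height C M c γ r ∧ p (k' + 1) r = j'
      · obtain ⟨r', hr', rfl⟩ := hex'
        have h2 : (partner (height C M c γ) p (i', p (k' + 1) r', k')).2 = (p k' r', k') := by
          rcases partner_eq_of_step hp hγ (i := i') hr' with ⟨-, h⟩ | ⟨-, h⟩ <;> rw [h]
        rw [← he, h1, Prod.mk.injEq] at h2
        obtain ⟨h2, rfl⟩ := h2
        have hkc : k < c := hd.2.2.2.1
        obtain rfl := hp.nonColliding k hkc r r' hr.le hr'.le h2
        rw [show i = i' by omega]
      · rw [partner_eq_of_not (d := (i', j', k')) hex'] at he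
        simp only [he, Prod.mk.injEq] at h1
        obtain ⟨h1, rfl⟩ := h1
        exact absurd ⟨r, by omega, h1.symm⟩ hex'
    · by_cases hex' : ∃ r, k' < height C M c γ r ∧ p (k' + 1) r = j'
      · obtain ⟨r', hr', rfl⟩ := hex'
        have h2 : (partner (height C M c γ) p (i', p (k' + 1) r', k')).2 = (p k' r', k') := by
          rcases partner_eq_of_step hp hγ (i := i') hr' with ⟨-, h⟩ | ⟨-, h⟩ <;> rw [h]
        rw [partner_eq_of_not (d := (i, j, k)) hex] at he
        simp only [← he, Prod.mk.injEq] at h2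
        obtain ⟨h2, rfl⟩ := h2
        exact absurd ⟨r', by omega, h2.symm⟩ hex
      · rw [partner_eq_of_not (d := (i, j, k)) hex, partner_eq_of_not (d := (i', j', k')) hex'] at he
        simp only [Prod.mk.injEq] at he ⊢
        omega
  · rintro ⟨i, j, k⟩ ⟨hu, hus⟩
    simp only [deg] at hus
    by_cases hex : ∃ r, k < height C M c γ r ∧ p k r = j
    · obtain ⟨r, hr, rfl⟩ := hex
      obtain ⟨-, -, -, hle⟩ := hp.mem_region H hr
      have hmem : ∀ d, d = (s - p (k + 1) r - k, p (k + 1) r, k) → d.1 ≤ i → d ∈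
          region s a b c α β γ := by
        rintro d rfl hdi
        have := hp.step_le k r
        obtain ⟨-, h1, h2, h3, h4⟩ := hu
        simp only at h1 h2 h3 h4 hdi
        exact ⟨Or.inl (by simp only; omega), by simp only; omega, by simp only; omega, h3,
          by simp only; omega⟩
      refine ⟨(s - p (k + 1) r - k, p (k + 1) r, k), ⟨hmem _ rfl ?_, ?_⟩, ?_⟩
      · have := hp.step_le k r
        simp only
        omega
      · simp only [deg]
        omega
      · rcases partner_eq_of_step hp hγ (i := s - p (k + 1) r - k) hr with ⟨h, h'⟩ | ⟨h, h'⟩ <;>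
          rw [h'] <;> simp only [Prod.mk.injEq, and_true] <;> omega
    · obtain ⟨-, h1, h2, h3, h4⟩ := hu
      simp only at h1 h2 h3 h4
      have hA := H.hA
      have hB := H.hB
      have hM := H.hM
      have hA' := H.hA'
      have hB' := H.hB'
      have hC' := H.hC'
      have hs := H.hs
      have hC := H.hC
      -- A particle just starting at height `k` would put the triangle in the corner or in the
      -- puncture.
      have hex2 : ¬ ∃ r, k ≤ height C M c γ r ∧ p k r = j := by
        rintro ⟨r, hr, hrj⟩
        rcases (show k < height C M c γ r ∨ height C M c γ r = k by omega) with h | h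
        · exact hex ⟨r, h, hrj⟩
        · rw [hp.eq_of_height_le r h.le] at hrj
          have hrlt := r.2
          rcases lt_or_ge (r : ℕ) C with hrC | hrC
          · rw [height_of_lt hrC] at h
            omega
          · rw [height_of_ge hrC] at h
            rw [source_of_ge hrC] at hrj
            omega
      -- At height `0` all positions from `A` to `b - 1` are occupied.
      have hk : k ≠ 0 := by
        rintro rfl
        obtain ⟨r, hr⟩ := hp.exists_bottom (by omega) (show A ≤ j by omega) (by omega)
        exact hex2 ⟨r, Nat.zero_le _, hr⟩
      obtain ⟨k, rfl⟩ := Nat.exists_eq_succ_of_ne_zero hk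
      refine ⟨(i, j, k), ⟨⟨Or.inl (by simp only; omega), h1, h2, by simp only; omega,
        by simp only; omega⟩, by simp only [deg]; omega⟩, ?_⟩
      rw [partner_eq_of_not]
      rintro ⟨r, hr, hrj⟩
      exact hex2 ⟨r, hr, hrj⟩

/-- The lozenge tiling given by a family of paths. -/
noncomputable def tilingOf (s a b c α β γ : ℕ) (p : ℕ → Fin (C + M) → ℕ) :
    Set (Set (ℕ × ℕ × ℕ)) :=
  (fun d => {d, partner (height C M c γ) p d}) '' {d | d ∈ region s a b c α β γ ∧ deg d = s}

lemma IsPathFamily.isLozengeTiling_tilingOf (hp : IsPathFamily A C M c β γ p)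
    (H : Admissible a b c α β γ s A B C M) :
    IsLozengeTiling (region s a b c α β γ) (tilingOf s a b c α β γ p) :=
  isLozengeTiling_of_bijOn (covers_partner _ p) (hp.bijOn_partner H)

/-- The tiling determines each step from the position before it, hence the whole family from the top
down. -/
lemma IsPathFamily.mem_tilingOf_iff (hp : IsPathFamily A C M c β γ p)
    (H : Admissible a b c α β γ s A B C M) {k : ℕ} {r : Fin (C + M)}
    (hr : k < height C M c γ r) :
    ({(s - p (k + 1) r - k, p (k + 1) r, k), (s - p (k + 1) r - k, p (k + 1) r + 1, k)} ∈
      tilingOf s a b c α β γ p) ↔ p k r = p (k + 1) r + 1 := by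
  have hst := partner_eq_of_step hp H.hγ (i := s - p (k + 1) r - k) hr
  constructor
  · rintro ⟨d, hd, he⟩
    obtain ⟨h1, h2⟩ := pair_inj (covers_partner _ p d).deg_eq (by simp only [deg]; omega) he
    rw [h1] at h2
    rcases hst with ⟨h, h'⟩ | ⟨h, h'⟩
    · rw [h2] at h'
      simp at h'
    · exact h
  · intro h
    rcases hst with ⟨h', -⟩ | ⟨-, h'⟩
    · omega
    · obtain ⟨i, hi, hu, hle⟩ := hp.mem_region H hr
      refine ⟨(s - p (k + 1) r - k, p (k + 1) r, k), ⟨?_, ?_⟩, ?_⟩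
      · obtain ⟨-, h1, h2, h3, h4⟩ := hu
        simp only at h1 h2 h3 h4
        exact ⟨Or.inl (by simp only; omega), by simp only; omega, by simp only; omega, h3,
          by simp only; omega⟩
      · simp only [deg]
        omega
      · simp only [h', h]

lemma tilingOf_injOn (H : Admissible a b c α β γ s A B C M) :
    Set.InjOn (tilingOf (C := C) (M := M) s a b c α β γ) {p | IsPathFamily A C M c β γ p} := by
  intro p hp p' hp' he
  have hp : IsPathFamily A C M c β γ p := hp
  have hp' : IsPathFamily A C M c β γ p' := hp'
  have key : ∀ d k, c ≤ k + d → p k = p' k := by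
    intro d
    induction d with
    | zero => intro k hk; rw [hp.top k hk, hp'.top k hk]
    | succ d ih =>
      intro k hk
      have ih := ih (k + 1) (by omega)
      funext r
      have h1 := hp.step_le k r
      have h2 := hp'.step_le k r
      by_cases hr : k < height C M c γ r
      · have h3 := hp.mem_tilingOf_iff H hr
        have h4 := hp'.mem_tilingOf_iff H hr
        rw [← ih, ← he, h3] at h4
        rw [← ih] at h2
        omega
      · rw [h1.2.2 (by omega), h2.2.2 (by omega), ih]
  funext k
  exact key c k (by omega)

end PuncturedHexagon

namespace PuncturedHexagon

variable {a b c α β γ s A B C M : ℕ} {T : Set (Set (ℕ × ℕ × ℕ))} {p : ℕ → Fin (C + M) → ℕ}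

/-! ### From tilings to path families -/

/-- The particles follow the lozenges of `T`. -/
structure Follows (s C M c β γ : ℕ) (T : Set (Set (ℕ × ℕ × ℕ))) (p : ℕ → Fin (C + M) → ℕ) :
    Prop where
  top : ∀ k, c ≤ k → p k = source C M β
  moving : ∀ k r, k < height C M c γ r →
    {(s - p (k + 1) r - k, p (k + 1) r, k), (s - p (k + 1) r - k, p (k + 1) r + 1, k)} ∈ T →
    p k r = p (k + 1) r + 1
  resting : ∀ k r, ¬ (k < height C M c γ r ∧
    {(s - p (k + 1) r - k, p (k + 1) r, k), (s - p (k + 1) r - k, p (k + 1) r + 1, k)} ∈ T) →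
    p k r = p (k + 1) r

lemma height_le (hγ : γ ≤ c) (r : Fin (C + M)) : height C M c γ r ≤ c := by
  unfold height; split_ifs <;> omega

/-- The rule is deterministic; the recursion runs over the depth `c - k`, starting from the sources.
-/
lemma exists_follows (hγ : γ ≤ c) (T : Set (Set (ℕ × ℕ × ℕ))) :
    ∃ p, Follows s C M c β γ T p := by
  classical
  let next : ℕ → (Fin (C + M) → ℕ) → Fin (C + M) → ℕ := fun k q r =>
    if k < height C M c γ r ∧ {(s - q r - k, q r, k), (s - q r - k, q r + 1, k)} ∈ T then q r + 1
    else q r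
  let g : ℕ → Fin (C + M) → ℕ := fun d =>
    Nat.rec (source C M β) (fun d q => next (c - (d + 1)) q) d
  have hg : ∀ k < c, g (c - k) = next k (g (c - (k + 1))) := fun k hk => by
    rw [show c - k = (c - (k + 1)) + 1 by omega]
    change next (c - (c - (k + 1) + 1)) _ = _
    congr 1
    omega
  refine ⟨fun k => g (c - k), fun k hk => ?_, fun k r hk hT => ?_, fun k r h => ?_⟩
  · simp only [Nat.sub_eq_zero_of_le hk]
    rfl
  · have := height_le (M := M) hγ r
    rw [hg k (by omega)]
    exact if_pos ⟨hk, hT⟩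
  · rcases lt_or_ge k c with hk | hk
    · rw [hg k hk]
      exact if_neg h
    · simp only [Nat.sub_eq_zero_of_le hk, Nat.sub_eq_zero_of_le (hk.trans (Nat.le_succ k))]

lemma Follows.eq_of_height_le (hp : Follows s C M c β γ T p) {k : ℕ} (r : Fin (C + M))
    (hk : height C M c γ r ≤ k) : p k r = source C M β r := by
  have key : ∀ d k, height C M c γ r ≤ k → c ≤ k + d → p k r = source C M β r := by
    intro d
    induction d with
    | zero => intro k _ hk; rw [hp.top k hk]
    | succ d ih =>
      intro k h1 h2
      rw [hp.resting k r (by omega), ih (k + 1) (by omega) (by omega)]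
  exact key c k hk (by omega)

/-- A moving particle enters a unit triangle that is not covered vertically and leaves it along a
lozenge of the tiling. -/
lemma Follows.exists_lozenge (hp : Follows s C M c β γ T p)
    (hT : IsLozengeTiling (region s a b c α β γ) T) (H : Admissible a b c α β γ s A B C M)
    {k : ℕ} {r : Fin (C + M)} (hr : k < height C M c γ r) :
    ∃ i i', i + p (k + 1) r + k = s ∧ i' + p k r + k = s + 1 ∧
      {(i, p (k + 1) r, k), (i', p k r, k)} ∈ T := by
  obtain ⟨hα, hβ, hγ, -, -, -, hs, hA, hB, hC, hM, hA', hB', hC'⟩ := H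
  have hrlt := r.2
  have next : ∀ k, k < height C M c γ r →
      (∃ i, i + p (k + 1) r + k = s ∧ (i, p (k + 1) r, k) ∈ region s a b c α β γ ∧
        {(i, p (k + 1) r, k), (i, p (k + 1) r, k + 1)} ∉ T) →
      ∃ i i', i + p (k + 1) r + k = s ∧ i' + p k r + k = s + 1 ∧
        {(i, p (k + 1) r, k), (i', p k r, k)} ∈ T := by
    rintro k hr ⟨i, hi, hd, hn⟩
    obtain ⟨u, hdu, hu, hduT⟩ := hT.exists_up hd (by simp only [deg]; omega)
    have hi' : s - p (k + 1) r - k = i := by omega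
    rcases hdu with rfl | rfl | rfl
    · have hk : p k r = p (k + 1) r := by
        refine hp.resting k r fun h => ?_
        rw [hi'] at h
        have := (hT.unique (by simp only [deg]; omega) (by simp only [deg]; omega) hduT h.2
          (Or.inl rfl)).2
        simp at this
      exact ⟨i, i + 1, hi, by omega, by rwa [hk]⟩
    · have hk : p k r = p (k + 1) r + 1 := hp.moving k r hr (by rwa [hi'])
      exact ⟨i, i, hi, by omega, by rwa [hk]⟩
    · exact absurd hduT hn
  -- The triangle below a particle is not matched upwards: at the start its upper neighbour is
  -- removed, and later that neighbour is already covered by the particle's previous lozenge.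
  have key : ∀ d k, height C M c γ r = k + 1 + d →
      ∃ i, i + p (k + 1) r + k = s ∧ (i, p (k + 1) r, k) ∈ region s a b c α β γ ∧
        {(i, p (k + 1) r, k), (i, p (k + 1) r, k + 1)} ∉ T := by
    intro d
    induction d with
    | zero =>
      intro k hk
      rw [hp.eq_of_height_le r (by omega)]
      rcases lt_or_ge (r : ℕ) C with hrC | hrC
      · rw [height_of_lt hrC] at hk
        rw [source_of_lt hrC]
        refine ⟨s - r - k, by omega, ⟨Or.inl (by simp only; omega), by simp only; omega,
          by simp only; omega, by simp only; omega, by simp only; omega⟩, fun h => ?_⟩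
        have := (hT.mem_region h).2.2.2.2.1
        simp only at this
        omega
      · rw [height_of_ge hrC] at hk
        rw [source_of_ge hrC]
        refine ⟨s - (β + (r - C)) - k, by omega, ⟨Or.inl (by simp only; omega),
          by simp only; omega, by simp only; omega, by simp only; omega, by simp only; omega⟩,
          fun h => ?_⟩
        have := (hT.mem_region h).2.2.2.2.2
        simp only at this
        omega
    | succ d ih =>
      intro k hk
      obtain ⟨i, i', hi, hi', hL⟩ := next (k + 1) (by omega) (ih (k + 1) (by omega))
      have hu := (hT.mem_region hL).2
      refine ⟨i', by omega, ?_, fun h => ?_⟩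
      · obtain ⟨-, h1, h2, h3, h4⟩ := hu
        simp only at h1 h2 h3 h4
        exact ⟨Or.inl (by simp only; omega), h1, h2, by simp only; omega, by simp only; omega⟩
      · have := (hT.unique (by simp only [deg]; omega) (by simp only [deg]; omega) hL h
          (Or.inr rfl)).1
        simp at this
  obtain ⟨d, hd⟩ := Nat.exists_eq_add_of_le (show k + 1 ≤ height C M c γ r from hr)
  exact next k hr (key d k hd)

lemma Follows.isPathFamily (hp : Follows s C M c β γ T p)
    (hT : IsLozengeTiling (region s a b c α β γ) T) (H : Admissible a b c α β γ s A B C M) :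
    IsPathFamily A C M c β γ p := by
  have hγ := H.hγ
  have hM := H.hM
  refine ⟨⟨hp.top, fun k _ r => ?_, ?_⟩, fun r => ?_⟩
  · by_cases h : k < height C M c γ r ∧
      {(s - p (k + 1) r - k, p (k + 1) r, k), (s - p (k + 1) r - k, p (k + 1) r + 1, k)} ∈ T
    · exact Or.inr ⟨h.1, hp.moving k r h.1 h.2⟩
    · exact Or.inl (hp.resting k r h)
  -- A moving particle that meets one just starting at the puncture would itself be in the puncture.
  · have hmixed : ∀ k r r', height C M c γ r = k → k < height C M c γ r' → p k r ≠ p k r' := by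
      intro k r r' hr hr' he
      have hle := height_le (M := M) hγ.le r'
      have hrlt := r.2
      rcases lt_or_ge (r : ℕ) C with hrC | hrC
      · rw [height_of_lt hrC] at hr
        omega
      · obtain ⟨i, i', -, hi', hL⟩ := hp.exists_lozenge hT H hr'
        have hu := (hT.mem_region hL).2.2.2.2.2
        rw [hp.eq_of_height_le r hr.le, source_of_ge hrC] at he
        rw [height_of_ge hrC] at hr
        simp only at hu
        omega
    have key : ∀ d k, c = k + d → NonColliding (height C M c γ) k (p k) := by
      intro d
      induction d with
      | zero =>
        intro k hk r r' hr hr' he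
        have hlt : ∀ r : Fin (C + M), k ≤ height C M c γ r → (r : ℕ) < C := fun r hr => by
          unfold height at hr; split_ifs at hr <;> omega
        rw [hp.top k (by omega), source_of_lt (hlt r hr), source_of_lt (hlt r' hr')] at he
        exact Fin.ext he
      | succ d ih =>
        intro k hk r r' hr hr' he
        rcases hr.lt_or_eq with h | h <;> rcases hr'.lt_or_eq with h' | h'
        · obtain ⟨i, i₁, hi, hi₁, hL⟩ := hp.exists_lozenge hT H h
          obtain ⟨i', i₁', hi', hi₁', hL'⟩ := hp.exists_lozenge hT H h'
          have := (hT.unique (by simp only [deg]; omega) (by simp only [deg]; omega) hL hL'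
            (Or.inr (by rw [he, show i₁ = i₁' by omega]))).1
          simp only [Prod.mk.injEq] at this
          exact ih (k + 1) (by omega) r r' h h' this.2.1
        · exact absurd he.symm (hmixed k r' r h'.symm h)
        · exact absurd he (hmixed k r r' h.symm h')
        · rw [hp.eq_of_height_le r h.ge, hp.eq_of_height_le r' h'.ge] at he
          rcases lt_or_ge (r : ℕ) C with hrC | hrC <;> rcases lt_or_ge (r' : ℕ) C with hrC' | hrC'
          · rw [source_of_lt hrC, source_of_lt hrC'] at he
            exact Fin.ext he
          · rw [height_of_lt hrC] at h
            rw [height_of_ge hrC'] at h'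
            omega
          · rw [height_of_ge hrC] at h
            rw [height_of_lt hrC'] at h'
            omega
          · rw [source_of_ge hrC, source_of_ge hrC'] at he
            exact Fin.ext (by omega)
    intro k hk
    obtain ⟨d, hd⟩ := Nat.exists_eq_add_of_le hk.le
    exact key d k hd
  · have hrlt := r.2
    have hA := H.hA
    have hB := H.hB
    have hC := H.hC
    have hs := H.hs
    have hA' := H.hA'
    have hB' := H.hB'
    by_cases h : 0 < height C M c γ r
    · obtain ⟨i, i', -, hi', hL⟩ := hp.exists_lozenge hT H h
      obtain ⟨-, h1, h2, -⟩ := (hT.mem_region hL).2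
      simp only at h1 h2
      omega
    · have hrC : C ≤ (r : ℕ) := by
        by_contra! hrC
        rw [height_of_lt hrC] at h
        omega
      rw [hp.eq_of_height_le r (by omega), source_of_ge hrC]
      rw [height_of_ge hrC] at h
      omega

/-- Trace upwards: the upper neighbour is either removed, so a particle starts there, or covered by
a lozenge of one of the first two types, which carries a particle by induction. -/
lemma Follows.exists_particle (hp : Follows s C M c β γ T p)
    (hT : IsLozengeTiling (region s a b c α β γ) T) (H : Admissible a b c α β γ s A B C M)
    {i j k : ℕ} (hd : (i, j, k) ∈ region s a b c α β γ) (hs : i + j + k = s)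
    (hn : {(i, j, k), (i, j, k + 1)} ∉ T) :
    ∃ r, k < height C M c γ r ∧ p (k + 1) r = j := by
  obtain ⟨hα, hβ, hγ, -, -, -, -, hA, hB, hC, hM, hA', hB', hC'⟩ := H
  have key : ∀ d i j k, c ≤ k + d → (i, j, k) ∈ region s a b c α β γ → i + j + k = s →
      {(i, j, k), (i, j, k + 1)} ∉ T → ∃ r, k < height C M c γ r ∧ p (k + 1) r = j := by
    intro d
    induction d with
    | zero =>
      intro i j k hk hd
      have := hd.2.2.2.1
      simp only at this
      omega
    | succ d ih =>
      intro i j k hk hd hs hn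
      obtain ⟨-, h1, h2, h3, h4⟩ := hd
      simp only at h1 h2 h3 h4
      by_cases hu : (i, j, k + 1) ∈ region s a b c α β γ
      · obtain ⟨⟨i', j', k'⟩, hcov, hds, hd', hL⟩ := hT.exists_down hu (by simp only [deg]; omega)
        have hz : ∀ i' j', (i', j', k + 1) ∈ region s a b c α β γ → i' + j' + (k + 1) = s →
            {(i', j', k + 1), (i, j, k + 1)} ∈ T → ∃ r, k + 1 < height C M c γ r ∧
              p (k + 1 + 1) r = j' := by
          intro i' j' hd' hs' hL
          refine ih i' j' (k + 1) (by omega) hd' hs' fun h => ?_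
          have := (hT.unique (by simp only [deg]; omega) (by simp only [deg]; omega) hL h
            (Or.inl rfl)).2
          simp at this
        simp only [deg] at hds
        rcases hcov with he | he | he <;> simp only [Prod.mk.injEq] at he <;>
          obtain ⟨rfl, rfl, he⟩ := he
        · subst he
          obtain ⟨r, hr, hrj⟩ := hz i' j hd' hds hL
          refine ⟨r, by omega, ?_⟩
          rw [hp.resting (k + 1) r, hrj]
          rintro ⟨-, h⟩
          rw [hrj, show s - j - (k + 1) = i' by omega] at h
          have := (hT.unique (by simp only [deg]; omega) (by simp only [deg]; omega) hL h
            (Or.inl rfl)).2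
          simp at this
        · subst he
          obtain ⟨r, hr, hrj⟩ := hz i j' hd' hds hL
          refine ⟨r, by omega, ?_⟩
          rw [hp.moving (k + 1) r hr, hrj]
          rwa [hrj, show s - j' - (k + 1) = i by omega]
        · obtain rfl : k = k' := by omega
          exact absurd hL hn
      · have : k + 1 = c ∨ (α ≤ i ∧ β ≤ j ∧ γ = k + 1) := by
          by_contra hcon
          exact hu ⟨Or.inr (by simp only; omega), h1, h2, by simp only; omega,
            by simp only; omega⟩
        rcases this with rfl | ⟨g1, g2, rfl⟩
        · have hj : ((⟨j, by omega⟩ : Fin (C + M)) : ℕ) < C := by simp only; omega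
          refine ⟨⟨j, by omega⟩, ?_, ?_⟩
          · rw [height_of_lt hj]
            omega
          · rw [hp.top _ le_rfl, source_of_lt hj]
        · have hj : C ≤ ((⟨C + (j - β), by omega⟩ : Fin (C + M)) : ℕ) := by simp
          refine ⟨⟨C + (j - β), by omega⟩, ?_, ?_⟩
          · rw [height_of_ge hj]
            omega
          · rw [hp.eq_of_height_le _ (height_of_ge hj).le, source_of_ge hj]
            simp only
            omega
  exact key c i j k (by omega) hd hs hn

lemma exists_tilingOf_eq (hT : IsLozengeTiling (region s a b c α β γ) T)
    (H : Admissible a b c α β γ s A B C M) :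
    ∃ p : ℕ → Fin (C + M) → ℕ, IsPathFamily A C M c β γ p ∧ tilingOf s a b c α β γ p = T := by
  obtain ⟨p, hp⟩ := exists_follows (s := s) (C := C) (M := M) (β := β) H.hγ.le T
  have hpf := hp.isPathFamily hT H
  refine ⟨p, hpf, hT.eq_of_subset (hpf.isLozengeTiling_tilingOf H) ?_⟩
  rintro _ ⟨⟨i, j, k⟩, ⟨hd, hds⟩, rfl⟩
  simp only [deg] at hds
  by_cases hex : ∃ r, k < height C M c γ r ∧ p (k + 1) r = j
  · obtain ⟨r, hr, rfl⟩ := hex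
    obtain ⟨i₁, i', hi, hi', hL⟩ := hp.exists_lozenge hT H hr
    obtain rfl : i₁ = i := by omega
    rcases partner_eq_of_step hpf H.hγ (i := i₁) hr with ⟨h, h'⟩ | ⟨h, h'⟩ <;> simp only [h']
    · rwa [show i₁ + 1 = i' by omega]
    · rwa [show (i₁, p k r, k) = (i', p k r, k) by simp only [Prod.mk.injEq, and_true]; omega]
  · simp only [partner_eq_of_not (d := (i, j, k)) hex]
    by_contra hn
    exact hex (hp.exists_particle hT H hd hds hn)

theorem ncard_isLozengeTiling (H : Admissible a b c α β γ s A B C M) :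
    {T | IsLozengeTiling (region s a b c α β γ) T}.ncard =
      {p | IsPathFamily A C M c β γ p}.ncard := by
  rw [← (tilingOf_injOn H).ncard_image]
  congr 1
  ext T
  constructor
  · exact fun hT => exists_tilingOf_eq hT H
  · rintro ⟨p, hp, rfl⟩
    exact IsPathFamily.isLozengeTiling_tilingOf hp H

/-! ### Existence of a tiling -/

/-- The first `l` corner particles pass the puncture on the near side and the others on the far
side. A corner particle makes `d` (near) or `e` (far) unit steps immediately, all above height `γ`,
and its remaining ones immediately below `γ`. The final positions are then consecutive: near corner
paths, puncture paths, far corner paths. -/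
lemma exists_isPathFamily (H : Admissible a b c α β γ s A B C M) :
    ∃ p, IsPathFamily A C M c β γ p := by
  obtain ⟨hα, hβ, hγ, -, -, -, hs, hA, hB, hC, hM, hA', hB', hC'⟩ := H
  -- The puncture particles shift by `A + l - β`, which must lie in `[0, γ]`; `C ≤ α + l` leaves
  -- room for the far paths to get past the puncture.
  obtain ⟨l, hl1, hl2, hl3, hl4, hl5⟩ : ∃ l, β ≤ A + l ∧ C ≤ α + l ∧ l ≤ C ∧ l ≤ β ∧
      A + l ≤ β + γ := ⟨max (β - A) (C - α), by omega⟩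
  -- `d + l ≤ β` keeps the near paths left of the puncture; the remaining `A - d` steps must fit
  -- below height `γ`.
  obtain ⟨d, hd1, hd2, hd3, hd4⟩ : ∃ d, A ≤ d + γ ∧ d ≤ A ∧ d + γ ≤ c ∧ d + l ≤ β :=
    ⟨A - γ, by omega⟩
  -- Far paths shift by `A + M` in total and must be at `β + M` or beyond at height `γ`; `d ≤ e`
  -- keeps them ahead of the near ones.
  obtain ⟨e, he1, he2, he3, he4, he5⟩ : ∃ e, A + M ≤ e + γ ∧ e ≤ A + M ∧ e + γ ≤ c ∧
      (l < C → β + M ≤ e + l) ∧ d ≤ e := ⟨max (max (A + M - γ) (β + M - l)) d, by omega⟩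
  refine ⟨fun k r => if (r : ℕ) < l then r + min d (c - k) + min (A - d) (γ - k)
    else if (r : ℕ) < C then r + min e (c - k) + min (A + M - e) (γ - k)
    else β + (r - C) + min (A + l - β) (γ - k), ⟨fun k hk => ?_, fun k hk r => ?_, ?_⟩, fun r => ?_⟩
  · funext r
    unfold source
    split_ifs <;> omega
  · unfold height
    split_ifs <;> omega
  · intro k hk r r' hr hr' he
    have h1 := r.2
    have h2 := r'.2
    unfold height at hr hr'
    refine Fin.ext ?_
    simp only at he
    split_ifs at * <;> omega
  · have h1 := r.2
    split_ifs <;> omega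

end PuncturedHexagon

namespace PuncturedHexagon

open MvPolynomial

/-! ### The weak Lefschetz property -/

section relation

variable {S : Type*} [CommRing S]

/-- Binomial expansion in the form of a row of `matrixN`: the shift `i` of the row is the extra
power of `y`. -/
lemma sum_binom_mul_pow (x y : S) (e i u n : ℕ) (hn : i + u + e = n) :
    ∑ q ∈ Finset.range (n + 1), ((binom e ((q : ℤ) - i) : ℤ) : S) * (x ^ (n - q) * y ^ q) =
      y ^ i * x ^ u * (x + y) ^ e := by
  subst hn
  have hsub : (Finset.range (e + 1)).map (addLeftEmbedding i) ⊆ Finset.range (i + u + e + 1) := by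
    intro q hq
    simp only [Finset.mem_map, Finset.mem_range, addLeftEmbedding_apply] at hq ⊢
    omega
  rw [← Finset.sum_subset hsub, Finset.sum_map, add_comm x y, add_pow, Finset.mul_sum]
  · refine Finset.sum_congr rfl fun m hm => ?_
    rw [Finset.mem_range] at hm
    rw [addLeftEmbedding_apply, show (((i + m : ℕ) : ℤ) - i) = (m : ℕ) by push_cast; ring,
      binom_natCast, show i + u + e - (i + m) = u + (e - m) by omega, pow_add, pow_add]
    push_cast
    ring
  · intro q _ hq
    have : binom e ((q : ℤ) - i) = 0 := by
      rcases lt_or_ge q i with h | h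
      · exact binom_of_neg _ (by omega)
      · obtain ⟨m, rfl⟩ := Nat.exists_eq_add_of_le h
        rw [show (((i + m : ℕ) : ℤ) - i) = (m : ℕ) by push_cast; ring, binom_natCast,
          Nat.choose_eq_zero_of_lt, Nat.cast_zero]
        by_contra! hme
        exact hq (Finset.mem_map.2 ⟨m, Finset.mem_range.2 (by omega), rfl⟩)
    rw [this, Int.cast_zero, zero_mul]

variable {a b c α β γ s A B C M : ℕ}

/-- The forms of degree `s + 1` in two elements `x` and `y` vanish when the determinant of
`matrixN` is invertible. -/
lemma pow_mul_pow_eq_zero (H : Admissible a b c α β γ s A B C M) {x y : S} (hx : x ^ a = 0)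
    (hy : y ^ b = 0) (hxy : (x + y) ^ c = 0) (hp : x ^ α * y ^ β * (x + y) ^ γ = 0)
    (hdet : IsUnit (((matrixN A C M c β γ).det : ℤ) : S)) (q : ℕ) :
    x ^ (s + 1 - q) * y ^ q = 0 := by
  obtain ⟨hα, hβ, hγ, -, -, -, hs, hA, hB, hC, hM, hA', hB', hC'⟩ := H
  -- For `q < A` the exponent of `x` is at least `a`; for `q ≥ A + C + M = b` the power of `y`
  -- vanishes.
  have hleft : ∀ q, q < A → x ^ (s + 1 - q) * y ^ q = 0 := fun q _ => by
    rw [pow_eq_zero_of_le (by omega) hx, zero_mul]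
  have hright : ∀ q, A + (C + M) ≤ q → x ^ (s + 1 - q) * y ^ q = 0 := fun q hq => by
    rw [pow_eq_zero_of_le (m := b) (by omega) hy, mul_zero]
  let v : Fin (C + M) → S := fun j => x ^ (s + 1 - (A + j)) * y ^ (A + (j : ℕ))
  have hsum : ∀ f : ℕ → S, ∑ q ∈ Finset.range (s + 1 + 1), f q * (x ^ (s + 1 - q) * y ^ q) =
      ∑ j : Fin (C + M), f (A + j) * v j := by
    intro f
    rw [Fin.sum_univ_eq_sum_range (fun j => f (A + j) * (x ^ (s + 1 - (A + j)) * y ^ (A + j))),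
      Finset.range_eq_Ico, Finset.range_eq_Ico,
      Finset.sum_Ico_add (fun q => f q * (x ^ (s + 1 - q) * y ^ q)) 0 (C + M) A]
    symm
    refine Finset.sum_subset (fun q hq => ?_) fun q _ hq => ?_
    · rw [Finset.mem_Ico] at hq ⊢
      omega
    · rw [Finset.mem_Ico] at hq
      rcases (show q < A ∨ A + (C + M) ≤ q by omega) with h | h
      · rw [hleft q h, mul_zero]
      · rw [hright q h, mul_zero]
  have hNv : ((matrixN A C M c β γ).map (Int.cast : ℤ → S)).mulVec v = 0 := by
    funext i
    simp only [Matrix.mulVec, dotProduct, Matrix.map_apply, matrixN, Matrix.of_apply,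
      Pi.zero_apply]
    have hi := i.2
    by_cases hiC : (i : ℕ) < C
    · simp only [if_pos hiC]
      -- The multiples `y^i x^(C-1-i) (x+y)^c` have degree `C - 1 + c = s + 1`.
      have h1 := sum_binom_mul_pow x y c i (C - 1 - i) (s + 1) (by omega)
      rw [hsum, hxy, mul_zero] at h1
      simpa using h1
    · simp only [if_neg hiC]
      -- Likewise, multiples of the fourth generator by forms of degree `M - 1` have degree `s + 1`.
      have h1 := sum_binom_mul_pow x y γ (β + (i - C)) (α + (M - 1 - (i - C))) (s + 1) (by omega)
      rw [hsum, pow_add, pow_add, show y ^ β * y ^ ((i : ℕ) - C) *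
        (x ^ α * x ^ (M - 1 - (i - C))) * (x + y) ^ γ = (x ^ α * y ^ β * (x + y) ^ γ) *
        (y ^ ((i : ℕ) - C) * x ^ (M - 1 - (i - C))) by ring, hp, zero_mul] at h1
      rw [← h1]
      refine Finset.sum_congr rfl fun j _ => ?_
      congr 3
      push_cast [Nat.cast_sub (not_lt.1 hiC)]
      ring
  have hv : v = 0 := by
    have hu : IsUnit ((matrixN A C M c β γ).map (Int.cast : ℤ → S)) := by
      rw [Matrix.isUnit_iff_isUnit_det]
      rwa [Int.cast_det] at hdet
    exact Matrix.mulVec_injective_of_isUnit hu (by rw [hNv, Matrix.mulVec_zero])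
  rcases (show q < A ∨ A + (C + M) ≤ q ∨ (A ≤ q ∧ q < A + (C + M)) by omega) with h | h | h
  · exact hleft q h
  · exact hright q h
  · have := congrFun hv ⟨q - A, by omega⟩
    simpa only [v, show A + (q - A) = q by omega, Pi.zero_apply] using this

lemma pow_mul_pow_mul_pow_eq_zero (H : Admissible a b c α β γ s A B C M) {x y : S}
    (hx : x ^ a = 0) (hy : y ^ b = 0) (hxy : (x + y) ^ c = 0)
    (hp : x ^ α * y ^ β * (x + y) ^ γ = 0)
    (hdet : IsUnit (((matrixN A C M c β γ).det : ℤ) : S)) {i j k : ℕ} (hq : s + 1 ≤ i + j + k) :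
    x ^ i * y ^ j * (x + y) ^ k = 0 := by
  have hxy' : ∀ i j, s + 1 ≤ i + j → x ^ i * y ^ j = 0 := by
    intro i j hij
    rcases le_total j (s + 1) with h | h
    · rw [show i = (s + 1 - j) + (i - (s + 1 - j)) by omega, pow_add, mul_right_comm,
        pow_mul_pow_eq_zero H hx hy hxy hp hdet, zero_mul]
    · have := pow_mul_pow_eq_zero H hx hy hxy hp hdet (s + 1)
      rw [Nat.sub_self, pow_zero, one_mul] at this
      rw [pow_eq_zero_of_le h this, mul_zero]
  rw [add_pow, Finset.mul_sum]
  refine Finset.sum_eq_zero fun m hm => ?_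
  rw [Finset.mem_range] at hm
  rw [← mul_assoc, show x ^ i * y ^ j * (x ^ m * y ^ (k - m)) =
    x ^ (i + m) * y ^ (j + (k - m)) by ring, hxy' _ _ (by omega), zero_mul]

end relation

/-! ### Membership in the monomial ideal -/

section monomialIdeal

variable {K : Type*} [Field K] {a b c α β γ : ℕ}

/-- The exponents of the monomials in the ideal. -/
def InIdeal (a b c α β γ : ℕ) (m : Fin 3 →₀ ℕ) : Prop :=
  a ≤ m 0 ∨ b ≤ m 1 ∨ c ≤ m 2 ∨ (α ≤ m 0 ∧ β ≤ m 1 ∧ γ ≤ m 2)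

lemma monomial_eq (m : Fin 3 →₀ ℕ) :
    (monomial m (1 : K)) = X 0 ^ m 0 * X 1 ^ m 1 * X 2 ^ m 2 := by
  rw [MvPolynomial.monomial_eq, C_1, one_mul, Finsupp.prod_fintype _ _ (by simp),
    Fin.prod_univ_three]

/-- The exponent with the given entries. -/
noncomputable def expo (i j k : ℕ) : Fin 3 →₀ ℕ := Finsupp.equivFunOnFinite.symm ![i, j, k]

@[simp] lemma expo_zero (i j k : ℕ) : expo i j k 0 = i := rfl
@[simp] lemma expo_one (i j k : ℕ) : expo i j k 1 = j := rfl
@[simp] lemma expo_two (i j k : ℕ) : expo i j k 2 = k := rfl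

lemma expo_le {i j k : ℕ} {m : Fin 3 →₀ ℕ} : expo i j k ≤ m ↔ i ≤ m 0 ∧ j ≤ m 1 ∧ k ≤ m 2 := by
  rw [Finsupp.le_def, Fin.forall_fin_succ, Fin.forall_fin_succ, Fin.forall_fin_one]
  rfl

lemma amaci_eq : amaci K a b c α β γ = Ideal.span ((fun m => monomial m (1 : K)) ''
    {expo a 0 0, expo 0 b 0, expo 0 0 c, expo α β γ}) := by
  rw [amaci]
  congr 1
  simp [Set.image_insert_eq, monomial_eq]

lemma mem_amaci {f : MvPolynomial (Fin 3) K} :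
    f ∈ amaci K a b c α β γ ↔ ∀ m ∈ f.support, InIdeal a b c α β γ m := by
  rw [amaci_eq, mem_ideal_span_monomial_image]
  simp [InIdeal, expo_le]

lemma degree_eq (m : Fin 3 →₀ ℕ) : m.degree = m 0 + m 1 + m 2 := by
  rw [Finsupp.degree_eq_sum, Fin.sum_univ_three]

end monomialIdeal

end PuncturedHexagon

/-! ### Monomial bases of the graded pieces and multiplication by `x + y - z` -/

namespace PuncturedHexagon

open MvPolynomial

variable {K : Type*} [Field K] {a b c α β γ s A B C M d : ℕ}

lemma mk_mem_gradedPiece {σ : Type*} {I : Ideal (MvPolynomial σ K)} {f : MvPolynomial σ K}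
    (hf : f.IsHomogeneous d) : Ideal.Quotient.mk I f ∈ gradedPiece I d :=
  ⟨f, hf, rfl⟩

lemma exists_of_mem_gradedPiece {σ : Type*} {I : Ideal (MvPolynomial σ K)}
    {y : MvPolynomial σ K ⧸ I} (hy : y ∈ gradedPiece I d) :
    ∃ f : MvPolynomial σ K, f.IsHomogeneous d ∧ Ideal.Quotient.mk I f = y :=
  hy

instance finite_gradedPiece {σ : Type*} [Finite σ] (I : Ideal (MvPolynomial σ K)) (d : ℕ) :
    Module.Finite K (gradedPiece I d) :=
  Module.Finite.iff_fg.2 ((homogeneousSubmodule_fg (σ := σ) (R := K) d).map _)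

lemma mul_mem_gradedPiece {σ : Type*} {I : Ideal (MvPolynomial σ K)} {e : ℕ}
    {x y : MvPolynomial σ K ⧸ I} (hx : x ∈ gradedPiece I d) (hy : y ∈ gradedPiece I e) :
    x * y ∈ gradedPiece I (d + e) := by
  obtain ⟨f, hf, rfl⟩ := exists_of_mem_gradedPiece hx
  obtain ⟨g, hg, rfl⟩ := exists_of_mem_gradedPiece hy
  rw [← map_mul]
  exact mk_mem_gradedPiece (hf.mul hg)

lemma homogeneousComponent_mul_of_isHomogeneous {σ : Type*} {f g : MvPolynomial σ K} {e : ℕ}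
    (hf : f.IsHomogeneous e) :
    homogeneousComponent (e + d) (f * g) = f * homogeneousComponent d g := by
  conv_lhs => rw [← sum_homogeneousComponent g, Finset.mul_sum, map_sum]
  have key : ∀ i, homogeneousComponent (e + d) (f * homogeneousComponent i g) =
      if i = d then f * homogeneousComponent d g else 0 := fun i => by
    rw [homogeneousComponent_of_mem (hf.mul (homogeneousComponent_isHomogeneous i g))]
    by_cases h : i = d
    · subst h
      simp
    · rw [if_neg h, if_neg (by omega)]
  simp only [key, Finset.sum_ite_eq', Finset.mem_range]
  split_ifs with h
  · rfl
  · rw [homogeneousComponent_eq_zero _ _ (by omega), mul_zero]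

/-- The exponents of the monomials that form a basis of `[R/I]_d`. -/
def basisExponents (a b c α β γ d : ℕ) : Set (Fin 3 →₀ ℕ) :=
  {m | m.degree = d ∧ ¬ InIdeal a b c α β γ m}

lemma mk_monomial {σ : Type*} (I : Ideal (MvPolynomial σ K)) (m : σ →₀ ℕ) (r : K) :
    Ideal.Quotient.mk I (monomial m r) = r • Ideal.Quotient.mk I (monomial m 1) := by
  rw [← Ideal.Quotient.mkₐ_eq_mk K, ← map_smul, smul_monomial, smul_eq_mul, mul_one]

lemma linearIndependent_monomial :
    LinearIndependent K fun m : basisExponents a b c α β γ d =>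
      Ideal.Quotient.mk (amaci K a b c α β γ) (monomial m.1 1) := by
  classical
  rw [linearIndependent_iff']
  intro t g hg m hm
  have hsum : (∑ m ∈ t, monomial m.1 (g m)) ∈ amaci K a b c α β γ := by
    rw [← Ideal.Quotient.eq_zero_iff_mem, map_sum, ← hg]
    exact Finset.sum_congr rfl fun m _ => mk_monomial _ _ _
  by_contra hne
  refine m.2.2 (mem_amaci.1 hsum m.1 ?_)
  rw [mem_support_iff, coeff_sum]
  simp only [coeff_monomial]
  rw [Finset.sum_eq_single m (fun m' _ h => if_neg fun h' => h (Subtype.ext h'))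
    (fun h => absurd hm h), if_pos rfl]
  exact hne

lemma span_monomial_eq_gradedPiece :
    Submodule.span K (Set.range fun m : basisExponents a b c α β γ d =>
      Ideal.Quotient.mk (amaci K a b c α β γ) (monomial m.1 1)) =
      gradedPiece (amaci K a b c α β γ) d := by
  refine le_antisymm (Submodule.span_le.2 ?_) fun y hy => ?_
  · rintro _ ⟨m, rfl⟩
    exact mk_mem_gradedPiece (isHomogeneous_monomial 1 m.2.1)
  · obtain ⟨f, hf, rfl⟩ := exists_of_mem_gradedPiece hy
    rw [← support_sum_monomial_coeff f, map_sum]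
    refine Submodule.sum_mem _ fun m hm => ?_
    by_cases h : InIdeal a b c α β γ m
    · have : (monomial m (coeff m f)) ∈ amaci K a b c α β γ := by
        refine mem_amaci.2 fun m' hm' => ?_
        rwa [Finset.mem_singleton.1 (support_monomial_subset hm')]
      rw [Ideal.Quotient.eq_zero_iff_mem.2 this]
      exact Submodule.zero_mem _
    · have hd : m.degree = d := by
        by_contra hne
        exact (mem_support_iff.1 hm) (hf.coeff_eq_zero hne)
      rw [mk_monomial]
      exact Submodule.smul_mem _ _ (Submodule.subset_span ⟨⟨m, hd, h⟩, rfl⟩)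

lemma finrank_gradedPiece :
    Module.finrank K (gradedPiece (amaci K a b c α β γ) d) =
      Nat.card (basisExponents a b c α β γ d) := by
  rw [← span_monomial_eq_gradedPiece]
  exact Module.finrank_eq_nat_card_basis (Module.Basis.span linearIndependent_monomial)

/-- The unit triangles of one orientation correspond to the monomials of one degree. -/
noncomputable def basisExponentsEquiv (hd : d = s ∨ d = s + 1) :
    basisExponents a b c α β γ d ≃ {t | t ∈ region s a b c α β γ ∧ deg t = d} where
  toFun m := ⟨(m.1 0, m.1 1, m.1 2), by
    have h1 := m.2.1
    have h2 := m.2.2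
    rw [degree_eq] at h1
    simp only [InIdeal, not_or, not_le] at h2
    exact ⟨⟨by simp only; omega, h2.1, h2.2.1, h2.2.2.1, h2.2.2.2⟩, h1⟩⟩
  invFun t := ⟨expo t.1.1 t.1.2.1 t.1.2.2, by
    obtain ⟨t, ⟨-, h1, h2, h3, h4⟩, h5⟩ := t
    refine ⟨by rw [degree_eq]; exact h5, ?_⟩
    simp only [InIdeal, expo_zero, expo_one, expo_two]
    omega⟩
  left_inv m := by
    refine Subtype.ext (Finsupp.ext fun i => ?_)
    fin_cases i <;> rfl
  right_inv t := rfl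

/-- The matching of unit triangles given by a path family is a bijection between the two monomial
bases. -/
lemma finrank_gradedPiece_succ (H : Admissible a b c α β γ s A B C M) :
    Module.finrank K (gradedPiece (amaci K a b c α β γ) s) =
      Module.finrank K (gradedPiece (amaci K a b c α β γ) (s + 1)) := by
  obtain ⟨p, hp⟩ := exists_isPathFamily H
  rw [finrank_gradedPiece, finrank_gradedPiece]
  exact Nat.card_congr (((basisExponentsEquiv (Or.inl rfl)).trans
    ((hp.bijOn_partner H).equiv _)).trans (basisExponentsEquiv (Or.inr rfl)).symm)

/-- The linear form `x + y - z`. -/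
noncomputable def linearForm (K : Type*) [Field K] : MvPolynomial (Fin 3) K := X 0 + X 1 - X 2

lemma isHomogeneous_linearForm : (linearForm K).IsHomogeneous 1 :=
  ((isHomogeneous_X K 0).add (isHomogeneous_X K 1)).sub (isHomogeneous_X K 2)

lemma monomial_mem_sup (H : Admissible a b c α β γ s A B C M)
    (hdet : (((matrixN A C M c β γ).det : ℤ) : K) ≠ 0) {m : Fin 3 →₀ ℕ} (hm : s + 1 ≤ m.degree) :
    monomial m (1 : K) ∈ amaci K a b c α β γ ⊔ Ideal.span {linearForm K} := by
  set Q := amaci K a b c α β γ ⊔ Ideal.span {linearForm K} with hQ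
  have hI : ∀ f ∈ ({X 0 ^ a, X 1 ^ b, X 2 ^ c, X 0 ^ α * X 1 ^ β * X 2 ^ γ} :
      Set (MvPolynomial (Fin 3) K)), Ideal.Quotient.mk Q f = 0 := fun f hf =>
    Ideal.Quotient.eq_zero_iff_mem.2 (Ideal.mem_sup_left (Ideal.subset_span hf))
  have hz : Ideal.Quotient.mk Q (X 2) = Ideal.Quotient.mk Q (X 0) + Ideal.Quotient.mk Q (X 1) := by
    rw [eq_comm, ← sub_eq_zero, ← map_add, ← map_sub]
    exact Ideal.Quotient.eq_zero_iff_mem.2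
      (Ideal.mem_sup_right (Ideal.subset_span (Set.mem_singleton _)))
  have hu : IsUnit (((matrixN A C M c β γ).det : ℤ) : MvPolynomial (Fin 3) K ⧸ Q) := by
    have := (isUnit_iff_ne_zero.2 hdet).map (algebraMap K (MvPolynomial (Fin 3) K ⧸ Q))
    rwa [map_intCast] at this
  rw [← Ideal.Quotient.eq_zero_iff_mem, monomial_eq, map_mul, map_mul, map_pow, map_pow, map_pow,
    hz]
  rw [degree_eq] at hm
  refine pow_mul_pow_mul_pow_eq_zero H ?_ ?_ ?_ ?_ hu hm
  · rw [← map_pow]; exact hI _ (by simp)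
  · rw [← map_pow]; exact hI _ (by simp)
  · rw [← hz, ← map_pow]; exact hI _ (by simp)
  · rw [← hz, ← map_pow, ← map_pow, ← map_pow, ← map_mul, ← map_mul]; exact hI _ (by simp)

/-- All forms of degree above `s` lie in `I + (ℓ)`. Taking the component of degree `d + 1` of `f = g
+ ℓ e` makes the cofactor homogeneous, and the monomial ideal `I` contains the component of `g`. -/
lemma surjOn_gradedPiece (H : Admissible a b c α β γ s A B C M)
    (hdet : (((matrixN A C M c β γ).det : ℤ) : K) ≠ 0) (hd : s ≤ d) :
    Set.SurjOn (fun f => Ideal.Quotient.mk (amaci K a b c α β γ) (linearForm K) * f)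
      (gradedPiece (amaci K a b c α β γ) d) (gradedPiece (amaci K a b c α β γ) (d + 1)) := by
  intro y hy
  obtain ⟨f, hf, rfl⟩ := exists_of_mem_gradedPiece hy
  have hfQ : f ∈ amaci K a b c α β γ ⊔ Ideal.span {linearForm K} := by
    rw [← support_sum_monomial_coeff f]
    refine Ideal.sum_mem _ fun m hm => ?_
    have hm' : m.degree = d + 1 := by
      by_contra hne
      exact (mem_support_iff.1 hm) (hf.coeff_eq_zero hne)
    rw [← mul_one (coeff m f), ← C_mul_monomial]
    exact Ideal.mul_mem_left _ _ (monomial_mem_sup H hdet (by omega))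
  obtain ⟨g, hg, e, he, rfl⟩ := Submodule.mem_sup.1 hfQ
  obtain ⟨e, rfl⟩ := Ideal.mem_span_singleton.1 he
  refine ⟨Ideal.Quotient.mk _ (homogeneousComponent d e),
    mk_mem_gradedPiece (homogeneousComponent_isHomogeneous d e), ?_⟩
  have h1 := homogeneousComponent_of_mem (m := d + 1) hf
  rw [if_pos rfl, map_add, add_comm d 1,
    homogeneousComponent_mul_of_isHomogeneous isHomogeneous_linearForm] at h1
  simp only
  rw [← map_mul, ← h1, map_add, right_eq_add, Ideal.Quotient.eq_zero_iff_mem]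
  refine mem_amaci.2 fun m hm => mem_amaci.1 hg m ?_
  rw [mem_support_iff, coeff_homogeneousComponent] at hm
  rw [mem_support_iff]
  exact fun h => hm (by rw [h, ite_self])

lemma injOn_gradedPiece_self (H : Admissible a b c α β γ s A B C M)
    (hdet : (((matrixN A C M c β γ).det : ℤ) : K) ≠ 0) :
    Set.InjOn (fun f => Ideal.Quotient.mk (amaci K a b c α β γ) (linearForm K) * f)
      (gradedPiece (amaci K a b c α β γ) s) := by
  let φ : gradedPiece (amaci K a b c α β γ) s →ₗ[K] gradedPiece (amaci K a b c α β γ) (s + 1) :=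
    (LinearMap.mulLeft K (Ideal.Quotient.mk (amaci K a b c α β γ) (linearForm K))).restrict
      fun x hx => by
        rw [add_comm]
        exact mul_mem_gradedPiece (mk_mem_gradedPiece isHomogeneous_linearForm) hx
  have hφ : Function.Surjective φ := by
    rintro ⟨y, hy⟩
    obtain ⟨x, hx, hxy⟩ := surjOn_gradedPiece H hdet le_rfl hy
    exact ⟨⟨x, hx⟩, Subtype.ext hxy⟩
  have hφ' := (LinearMap.injective_iff_surjective_of_finrank_eq_finrank
    (finrank_gradedPiece_succ H)).2 hφ
  intro x hx y hy hxy
  exact congrArg Subtype.val (@hφ' ⟨x, hx⟩ ⟨y, hy⟩ (Subtype.ext hxy))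

/-- There are no socle elements of degree less than `s`. -/
lemma inIdeal_of_forall (H : Admissible a b c α β γ s A B C M) {m : Fin 3 →₀ ℕ}
    (hm : m.degree < s) (h : ∀ i, InIdeal a b c α β γ (Finsupp.single i 1 + m)) :
    InIdeal a b c α β γ m := by
  obtain ⟨hα, hβ, hγ, -, -, -, hs, hA, hB, hC, hM, hA', hB', hC'⟩ := H
  have h0 := h 0
  have h1 := h 1
  have h2 := h 2
  rw [degree_eq] at hm
  -- A socle monomial has two exponents maximal (such as `b - 1` and `c - 1`), with the third either
  -- maximal or one short of the puncture; the numerical hypotheses then force degree at least `s`.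
  simp [InIdeal] at h0 h1 h2 ⊢
  omega

/-- If `ℓ` kills `f - g`, it kills each `X i * (f - g)`; injectivity one degree up makes `f - g` a
socle element, hence zero. -/
lemma injOn_gradedPiece_of_succ (H : Admissible a b c α β γ s A B C M) (hd : d < s)
    (h : Set.InjOn (fun f => Ideal.Quotient.mk (amaci K a b c α β γ) (linearForm K) * f)
      (gradedPiece (amaci K a b c α β γ) (d + 1))) :
    Set.InjOn (fun f => Ideal.Quotient.mk (amaci K a b c α β γ) (linearForm K) * f)
      (gradedPiece (amaci K a b c α β γ) d) := by
  intro x hx y hy hxy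
  obtain ⟨f, hf, rfl⟩ := exists_of_mem_gradedPiece hx
  obtain ⟨g, hg, rfl⟩ := exists_of_mem_gradedPiece hy
  have hX : ∀ i, X i * (f - g) ∈ amaci K a b c α β γ := fun i => by
    rw [mul_sub, ← Ideal.Quotient.eq]
    refine h (mk_mem_gradedPiece (add_comm 1 d ▸ (isHomogeneous_X K i).mul hf))
      (mk_mem_gradedPiece (add_comm 1 d ▸ (isHomogeneous_X K i).mul hg)) ?_
    simp only [map_mul] at hxy ⊢
    rw [mul_left_comm, hxy, mul_left_comm]
  rw [Ideal.Quotient.eq]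
  refine mem_amaci.2 fun m hm => ?_
  have hm' : m.degree = d := by
    by_contra hne
    exact (mem_support_iff.1 hm) ((hf.sub hg).coeff_eq_zero hne)
  refine inIdeal_of_forall H (by omega) fun i => mem_amaci.1 (hX i) _ ?_
  rw [mem_support_iff, coeff_X_mul]
  exact mem_support_iff.1 hm

theorem hasWLP_amaci (H : Admissible a b c α β γ s A B C M)
    (hdet : (((matrixN A C M c β γ).det : ℤ) : K) ≠ 0) : HasWLP (amaci K a b c α β γ) := by
  refine ⟨_, mk_mem_gradedPiece isHomogeneous_linearForm, fun d => ?_⟩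
  rcases le_total s d with hd | hd
  · exact Or.inr (surjOn_gradedPiece H hdet hd)
  · left
    induction hd using Nat.decreasingInduction with
    | self => exact injOn_gradedPiece_self H hdet
    | of_succ d hd ih => exact injOn_gradedPiece_of_succ H hd ih

end PuncturedHexagon

theorem mainTheorem5 (a b c α β γ s A B C M : ℕ)
    (hα : α < a) (hβ : β < b) (hγ : γ < c)
    (hαβ : ¬ (α = 0 ∧ β = 0)) (hαγ : ¬ (α = 0 ∧ γ = 0)) (hβγ : ¬ (β = 0 ∧ γ = 0))
    (hs : a + b + c + α + β + γ = 3 * (s + 2))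
    (hA : a + A = s + 2) (hB : b + B = s + 2) (hC : c + C = s + 2)
    (hM : α + β + γ + M = s + 2)
    (hA' : A ≤ β + γ) (hB' : B ≤ α + γ) (hC' : C ≤ α + β) :
    (∃ T, PuncturedHexagon.IsLozengeTiling (PuncturedHexagon.region s a b c α β γ) T) ∧
    (Even (a + b + c) →
      Even M ∧
      0 < (PuncturedHexagon.matrixN A C M c β γ).det ∧
      (PuncturedHexagon.matrixN A C M c β γ).det =
        ({T | PuncturedHexagon.IsLozengeTiling
          (PuncturedHexagon.region s a b c α β γ) T}.ncard : ℤ) ∧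
      (∀ (K : Type*) [Field K] [CharZero K],
        PuncturedHexagon.HasWLP (PuncturedHexagon.amaci K a b c α β γ)) ∧
      (∃ p₀ : ℕ, ∀ p : ℕ, p.Prime → p₀ ≤ p →
        ∀ (K : Type*) [Field K] [Infinite K] [CharP K p],
          PuncturedHexagon.HasWLP (PuncturedHexagon.amaci K a b c α β γ))) := by
  have H : PuncturedHexagon.Admissible a b c α β γ s A B C M :=
    ⟨hα, hβ, hγ, hαβ, hαγ, hβγ, hs, hA, hB, hC, hM, hA', hB', hC'⟩
  obtain ⟨p, hp⟩ := PuncturedHexagon.exists_isPathFamily H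
  refine ⟨⟨_, hp.isLozengeTiling_tilingOf H⟩, fun heven => ?_⟩
  -- The hypotheses give `a + b + c = 2 * (s + 2) + M`.
  have hMeven : Even M := by
    rw [Nat.even_iff] at heven ⊢
    omega
  have hdet := PuncturedHexagon.det_matrixN_eq_ncard (A := A) (C := C) (β := β) hγ hMeven
  have hpos : 0 < (PuncturedHexagon.matrixN A C M c β γ).det := by
    rw [hdet, Nat.cast_pos, Set.ncard_pos PuncturedHexagon.finite_isPathFamily]
    exact ⟨p, hp⟩
  refine ⟨hMeven, hpos, ?_, fun K _ _ => ?_, ?_⟩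
  · rw [hdet, PuncturedHexagon.ncard_isLozengeTiling H]
  · exact PuncturedHexagon.hasWLP_amaci H (Int.cast_ne_zero.2 hpos.ne')
  -- A prime larger than the positive determinant cannot divide it.
  · refine ⟨(PuncturedHexagon.matrixN A C M c β γ).det.toNat + 1,
      fun q _ hq K _ _ _ => PuncturedHexagon.hasWLP_amaci H ?_⟩
    rw [Ne, CharP.intCast_eq_zero_iff K q]
    intro hdvd
    have := Int.le_of_dvd hpos hdvd
    omega
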